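/- Let $\Sigma$ be a finite set of prime numbers. An integer $m$ is called a $\Sigma$-unit if all its prime divisors belong to $\Sigma$, and $\Sigma$-square-free if it is the product of a $\Sigma$-unit and a square-free integer; it is called composite if $|m|>1$ and $|m|$ is not prime. For real $z\ge 2$ put $P_\Sigma(z)=\prod_{p<z,\ p\notin\Sigma}p$, the product being over primes. Let $k\ge 1$ and let $a_1,\dots,a_k,b_1,\dots,b_k$ be integers such that $a_i\neq 0$ and $\gcd(a_i,b_i)=1$ for all $i$, and $a_ib_j-a_jb_i\neq 0$ for $1\le i<j\le k$. Put $L_i(n)=a_in+b_i$ and, for $x\ge z\ge 2$, $$\Omega(x,z)=\{n\in\mathbb Z: 1\le n\le x,\ \gcd(L_1(n)\cdots L_k(n),P_\Sigma(z))=1\},$$ $$\Omega_1(x,z)=\{n\in\Omega(x,z): L_1(n),\dots,L_k(n)\text{ are }\Sigma\text{-square-free composite numbers}\}.$$ **Theorem.** Assume that $\Sigma$ contains all primes $p\le 2k$, all prime divisors of every $a_i$, and all prime divisors of every $a_ib_j-a_jb_i$ with $i\ne j$. Then there exist real numbers $\eta,c_1\in(0,1/2]$ depending only on $k$ and on the cardinality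 $\#\Sigma$ (but not on $\Sigma$ itself, nor on the integers $a_i$, $b_i$), and $z_1\ge 2$ depending only on $a_1,\dots,a_k,b_1,\dots,b_k$, such that for all real $x\ge 2$ and $z$ with $x^\eta\ge z\ge z_1$ we have $$\#\Omega_1(x,z)\ge c_1\frac{x}{(\log z)^k}.$$ -/

import Mathlib

/-- `m` is an `S`-unit: all prime divisors of the integer `m` belong to `S`. -/
def IsSigmaUnit (S : Finset ℕ) (m : ℤ) : Prop :=
  ∀ p : ℕ, p.Prime → (p : ℤ) ∣ m → p ∈ S

/-- `m` is `S`-square-free: it is the product of an `S`-unit and a square-free integer. -/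
def IsSigmaSquarefree (S : Finset ℕ) (m : ℤ) : Prop :=
  ∃ u s : ℤ, IsSigmaUnit S u ∧ Squarefree s ∧ m = u * s

/-- An integer, of either sign, is composite when its absolute value is a composite natural
number: greater than `1` and not prime. -/
def IsCompositeInt (m : ℤ) : Prop :=
  1 < m.natAbs ∧ ¬ m.natAbs.Prime

/-- The product of all primes `p < z` that do not belong to `S`.
(For natural `p`, `p < ⌈z⌉₊` holds exactly when `p < z`.) -/
noncomputable def primeProd (S : Finset ℕ) (z : ℝ) : ℕ :=
  ∏ p ∈ (Finset.range ⌈z⌉₊).filter (fun p => p.Prime ∧ p ∉ S), p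

/-- The linear form `L_i(n) = a_i n + b_i`. -/
def linForm {k : ℕ} (a b : Fin k → ℤ) (i : Fin k) (n : ℕ) : ℤ :=
  a i * (n : ℤ) + b i

/-- The set `Ω(x, z)` of integers `1 ≤ n ≤ x` such that `L_1(n) ⋯ L_k(n)` is coprime to the
product of the primes below `z` outside `S`. -/
def sievedSet {k : ℕ} (S : Finset ℕ) (a b : Fin k → ℤ) (x z : ℝ) : Set ℕ :=
  {n : ℕ | 1 ≤ n ∧ (n : ℝ) ≤ x ∧
    Int.gcd (∏ i : Fin k, linForm a b i n) (primeProd S z : ℤ) = 1}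

/-- The set `Ω₁(x, z)` of those `n ∈ Ω(x, z)` for which all of `L_1(n), …, L_k(n)` are
`S`-square-free composite numbers. -/
def sievedSet₁ {k : ℕ} (S : Finset ℕ) (a b : Fin k → ℤ) (x z : ℝ) : Set ℕ :=
  {n : ℕ | n ∈ sievedSet S a b x z ∧
    ∀ i : Fin k, IsSigmaSquarefree S (linForm a b i n) ∧ IsCompositeInt (linForm a b i n)}

open Finset Real

/-! Every good `n` is produced together with a witness of compositeness. Put `w = z ^ A` and `y = z
^ A ^ (k + 1)`, with `A` depending only on `k` and `#S`, and cut the primes of `[w, y)` outside `S`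
into `k` consecutive blocks `I i` (`primeBlock`). For each choice of primes `pp i ∈ I i`, consider
the `n ≤ x` for which `pp i` divides the `i`-th form and no other prime below `y` outside `S`
divides any form (`tupleSet`). A lower-bound sieve of dimension `k` gives at least about `x * ∏ 1 /
pp i / (log y) ^ k` such `n` (`exists_card_tupleSet_lower_bound`).

The value `n` determines its tuple, so these sets are disjoint (`disjoint_tupleSet`) and their sizes
add up. The sum over tuples factors into `∏ i, ∑ p ∈ I i, 1 / p`. By Mertens each factor is at least
`1 / 4`, even after the primes of `S` are deleted (`quarter_le_sum_inv_primesUnder_sdiff`). Hence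
the total has order `x / (log z) ^ k`.

For such an `n`, every prime factor outside `S` of every form is at least `w ≥ z`, so `n` survives
the sieve by primes below `z`. The `i`-th form is divisible by `pp i < y`, hence composite unless
its absolute value is below `y`, which is rare. It is `S`-square-free unless `q ^ 2` divides it for
some prime `q ≥ w` outside `S`; this happens for about `x / w = x / z ^ A` values of `n`. Since `2 ^
A` beats the power of `A` lost in `(log y) ^ k`, a large `A` makes this loss negligible uniformly in
`z ≥ 2` (`card_biUnion_tupleSet_le`, `exists_exponent_and_constant`).

The sieve is Brun–Hooley (`exists_lower_sieve_weights`): primes are grouped into layers dyadic in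
`log p`, each layer is truncated by Bonferroni, and the truncation level grows as the primes get
smaller. A level of distribution `y ^ B` then suffices, with `B` depending on `k` alone. Uniformity
in `S` and in the forms holds because only the number `k` of forbidden classes modulo `p` enters. -/

/-! ### Mertens' first theorem, from the prime factorization of `N!` -/

/-- The logarithm of `N!` through the exponents of the primes up to `N`. -/
lemma log_factorial_eq_sum_primesLE (N : ℕ) :
    log (N.factorial : ℝ) = ∑ p ∈ Nat.primesLE N, (padicValNat p N.factorial : ℝ) * log p := by
  rw [Real.log_nat_eq_sum_factorization, Finsupp.sum]
  refine (Finset.sum_subset_zero_on_sdiff ?_ ?_ ?_)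
  · intro p hp
    rw [Nat.support_factorization, Nat.mem_primeFactors] at hp
    rw [Nat.mem_primesLE]
    exact ⟨(hp.1.dvd_factorial).1 hp.2.1, hp.1⟩
  · intro p hp
    rw [mem_sdiff, Nat.mem_primesLE, Finsupp.mem_support_iff, not_not] at hp
    rw [← Nat.factorization_def _ hp.1.2, hp.2]; simp
  · intro p hp
    rw [Nat.support_factorization, Nat.mem_primeFactors] at hp
    rw [← Nat.factorization_def _ hp.1]

lemma sub_one_le_padicValNat_factorial {p : ℕ} (hp : p.Prime) (N : ℕ) :
    (N : ℝ) / p - 1 ≤ padicValNat p N.factorial := by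
  have := Fact.mk hp
  have h1 : N / p ≤ padicValNat p N.factorial := by
    rw [← padicValNat_mul_div_factorial, padicValNat_factorial_mul]
    omega
  have h2 : (N : ℝ) / p < (N / p : ℕ) + 1 := by
    rw [div_lt_iff₀ (by exact_mod_cast hp.pos)]
    have h := Nat.lt_mul_div_succ N hp.pos
    rw [mul_comm] at h
    exact_mod_cast h
  have h3 : ((N / p : ℕ) : ℝ) ≤ padicValNat p N.factorial := by exact_mod_cast h1
  linarith

/-- Legendre's formula: `(p - 1)` times the valuation is `N` minus its base-`p` digit sum. -/
lemma padicValNat_factorial_le_div {p : ℕ} (hp : p.Prime) (N : ℕ) :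
    (padicValNat p N.factorial : ℝ) ≤ N / (p - 1) := by
  have := Fact.mk hp
  have h := sub_one_mul_padicValNat_factorial (p := p) N
  have h1 : (p - 1) * padicValNat p N.factorial ≤ N := by omega
  have hp1 : (1 : ℝ) < p := by exact_mod_cast hp.one_lt
  rw [le_div_iff₀ (by linarith), mul_comm]
  have : (((p - 1 : ℕ) : ℝ)) = (p : ℝ) - 1 := by
    rw [Nat.cast_sub hp.one_le]; simp
  rw [← this]
  exact_mod_cast h1

/-- Upper half of Mertens' first theorem. -/
lemma sum_log_div_primesLE_le (N : ℕ) (hN : 1 ≤ N) :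
    ∑ p ∈ Nat.primesLE N, log p / p ≤ log N + log 4 := by
  have hN0 : (0 : ℝ) < N := by exact_mod_cast hN
  have h1 : ∑ p ∈ Nat.primesLE N, ((N : ℝ) / p - 1) * log p ≤ log (N.factorial : ℝ) := by
    rw [log_factorial_eq_sum_primesLE]
    refine sum_le_sum fun p hp => ?_
    rw [Nat.mem_primesLE] at hp
    exact mul_le_mul_of_nonneg_right (sub_one_le_padicValNat_factorial hp.2 N)
      (log_natCast_nonneg p)
  have h2 : log (N.factorial : ℝ) ≤ N * log N := by
    rw [← log_pow]
    exact log_le_log (by exact_mod_cast N.factorial_pos) (by exact_mod_cast N.factorial_le_pow)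
  have h3 := Chebyshev.theta_le_log4_mul_x (x := (N : ℝ)) hN0.le
  rw [Chebyshev.theta_eq_sum_primesLE_log] at h3
  have h4 : ∑ p ∈ Nat.primesLE N, ((N : ℝ) / p - 1) * log p
      = N * ∑ p ∈ Nat.primesLE N, log p / p - ∑ p ∈ Nat.primesLE N, log p := by
    rw [mul_sum, ← sum_sub_distrib]
    exact sum_congr rfl fun p _ => by ring
  have h5 : N * ∑ p ∈ Nat.primesLE N, log p / p ≤ N * (log N + log 4) := by
    nlinarith
  exact le_of_mul_le_mul_left h5 hN0

/-- A telescoping majorant: `(log n + 2) / n` decreases fast enough to dominate `log n / (n * (n -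
1))`, and it equals `2` at `n = 1`. -/
lemma log_div_sub_log_div_le {n : ℕ} (hn : 2 ≤ n) :
    log n / (n - 1) - log n / n ≤
      (log ((n - 1 : ℕ) : ℝ) + 2) / ((n - 1 : ℕ) : ℝ) - (log n + 2) / n := by
  obtain ⟨m, rfl⟩ : ∃ m, n = m + 1 := ⟨n - 1, by omega⟩
  have hm : (1 : ℝ) ≤ m := by exact_mod_cast (by omega : 1 ≤ m)
  have h : log ((m : ℝ) + 1) ≤ log m + 1 / m := by
    have := Real.log_le_sub_one_of_pos (x := ((m : ℝ) + 1) / m) (by positivity)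
    rw [log_div (by positivity) (by positivity)] at this
    have e : ((m : ℝ) + 1) / m - 1 = 1 / m := by field_simp; ring
    linarith
  simp only [Nat.add_sub_cancel, Nat.cast_add, Nat.cast_one, add_sub_cancel_right]
  have key : (log (m : ℝ) + 2) / m - (log ((m : ℝ) + 1) + 2) / (m + 1)
      - (log ((m : ℝ) + 1) / m - log ((m : ℝ) + 1) / (m + 1))
      = ((log m - log ((m : ℝ) + 1)) * (m + 1) + 2) / (m * (m + 1)) := by
    field_simp; ring
  have h2 : 0 ≤ (log m - log ((m : ℝ) + 1)) * (m + 1) + 2 := by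
    have : (log m - log ((m : ℝ) + 1)) * (m + 1) ≥ -(1 / m) * (m + 1) :=
      mul_le_mul_of_nonneg_right (by linarith) (by positivity)
    have e : -(1 / (m : ℝ)) * (m + 1) = -1 - 1 / m := by field_simp; ring
    have : 1 / (m : ℝ) ≤ 1 := by rw [div_le_one (by positivity)]; exact hm
    linarith
  have := div_nonneg h2 (by positivity : (0 : ℝ) ≤ m * (m + 1))
  linarith

lemma sum_primesLE_log_div_sub_le (N : ℕ) :
    ∑ p ∈ Nat.primesLE N, (log p / (p - 1) - log p / p) ≤ 2 := by
  have h0 : ∀ n : ℕ, 2 ≤ n → 0 ≤ log n / ((n : ℝ) - 1) - log n / n := by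
    intro n hn
    have : (2 : ℝ) ≤ n := by exact_mod_cast hn
    rw [sub_nonneg]
    exact div_le_div_of_nonneg_left (log_nonneg (by linarith)) (by linarith) (by linarith)
  have h1 : ∑ p ∈ Nat.primesLE N, (log p / ((p : ℝ) - 1) - log p / p)
      ≤ ∑ n ∈ Ico 2 (N + 2), (log n / ((n : ℝ) - 1) - log n / n) := by
    refine sum_le_sum_of_subset_of_nonneg ?_ ?_
    · intro p hp
      rw [Nat.mem_primesLE] at hp
      rw [mem_Ico]; exact ⟨hp.2.two_le, by omega⟩
    · intro n hn _
      exact h0 n (mem_Ico.1 hn).1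
  have h2 : ∑ n ∈ Ico 2 (N + 2), (log n / ((n : ℝ) - 1) - log n / n) ≤
      2 - (log ((N + 1 : ℕ) : ℝ) + 2) / ((N + 1 : ℕ) : ℝ) := by
    clear h1
    induction N with
    | zero => simp
    | succ N ih =>
      rw [sum_Ico_succ_top (by omega)]
      have := log_div_sub_log_div_le (n := N + 2) (by omega)
      simp only [show N + 2 - 1 = N + 1 by omega] at this
      linarith
  have h3 : 0 ≤ (log ((N + 1 : ℕ) : ℝ) + 2) / ((N + 1 : ℕ) : ℝ) := by
    have := log_natCast_nonneg (N + 1)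
    positivity
  linarith

/-- Lower half of Mertens' first theorem. -/
lemma le_sum_log_div_primesLE (N : ℕ) (hN : 1 ≤ N) :
    log N - 3 ≤ ∑ p ∈ Nat.primesLE N, log p / p := by
  have hN0 : (0 : ℝ) < N := by exact_mod_cast hN
  have h1 : log (N.factorial : ℝ) ≤ N * ∑ p ∈ Nat.primesLE N, log p / ((p : ℝ) - 1) := by
    rw [log_factorial_eq_sum_primesLE, mul_sum]
    refine sum_le_sum fun p hp => ?_
    rw [Nat.mem_primesLE] at hp
    calc _ ≤ (N : ℝ) / (p - 1) * log p :=
          mul_le_mul_of_nonneg_right (padicValNat_factorial_le_div hp.2 N) (log_natCast_nonneg p)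
      _ = _ := by ring
  have h2 : N * log N - N ≤ log (N.factorial : ℝ) := by
    have := Stirling.le_log_factorial_stirling (n := N) (by omega)
    have h3 : 0 ≤ log (N : ℝ) := log_natCast_nonneg N
    have h4 : 0 ≤ log (2 * π) := log_nonneg (by linarith [Real.pi_gt_three])
    linarith
  have h3 := sum_primesLE_log_div_sub_le N
  rw [sum_sub_distrib] at h3
  have h5 : N * (log N - 1) ≤ N * ∑ p ∈ Nat.primesLE N, log p / ((p : ℝ) - 1) := by linarith
  have := le_of_mul_le_mul_left h5 hN0
  linarith

/-- The primes below the real number `y`. -/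
noncomputable def primesUnder (y : ℝ) : Finset ℕ := Nat.primesBelow ⌈y⌉₊

lemma mem_primesUnder {y : ℝ} {p : ℕ} : p ∈ primesUnder y ↔ (p : ℝ) < y ∧ p.Prime := by
  rw [primesUnder, Nat.mem_primesBelow, Nat.lt_ceil]

lemma primesUnder_mono {w y : ℝ} (h : w ≤ y) : primesUnder w ⊆ primesUnder y := fun p hp => by
  rw [mem_primesUnder] at *
  exact ⟨hp.1.trans_le h, hp.2⟩

/-- Mertens' first theorem. -/
theorem abs_sum_log_div_primesUnder_sub_log_le {y : ℝ} (hy : 1 ≤ y) :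
    |∑ p ∈ primesUnder y, log p / p - log y| ≤ 4 := by
  set N := ⌈y⌉₊ with hN
  have hy0 : 0 < y := by linarith
  have hN1 : 1 ≤ N := Nat.one_le_iff_ne_zero.2 (Nat.ceil_pos.2 hy0).ne'
  have hyN : y ≤ N := Nat.le_ceil y
  have hNy : (N : ℝ) < y + 1 := Nat.ceil_lt_add_one hy0.le
  have l1 : log y ≤ log N := log_le_log hy0 hyN
  have l2 : log N ≤ log y + log 2 := by
    rw [← log_mul hy0.ne' (by norm_num)]
    exact log_le_log (by positivity) (by linarith)
  have hlog2 : log 2 < 1 := by have := Real.log_two_lt_d9; linarith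
  have hlog4 : log 4 = 2 * log 2 := by
    rw [show (4 : ℝ) = 2 ^ 2 by norm_num, log_pow]; norm_num
  have hsub : primesUnder y ⊆ Nat.primesLE N := fun p hp => by
    rw [mem_primesUnder] at hp
    rw [Nat.mem_primesLE]
    exact ⟨by exact_mod_cast (hp.1.le.trans hyN), hp.2⟩
  have hnn : ∀ p ∈ Nat.primesLE N, 0 ≤ log (p : ℝ) / p := fun p _ =>
    div_nonneg (log_natCast_nonneg p) (Nat.cast_nonneg p)
  have u := sum_le_sum_of_subset_of_nonneg hsub (fun p hp _ => hnn p hp)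
  have hsub2 : Nat.primesLE N ⊆ insert N (primesUnder y) := fun p hp => by
    rw [Nat.mem_primesLE] at hp
    rw [mem_insert, primesUnder, Nat.mem_primesBelow]
    rcases hp.1.eq_or_lt with h | h
    · exact Or.inl h
    · exact Or.inr ⟨h, hp.2⟩
  have v := sum_le_sum_of_subset_of_nonneg (f := fun p : ℕ => log (p : ℝ) / p) hsub2
    (fun p _ _ => div_nonneg (log_natCast_nonneg p) (Nat.cast_nonneg p))
  have hNn : N ∉ primesUnder y := by
    rw [primesUnder, Nat.mem_primesBelow]; simp [hN]
  rw [sum_insert hNn] at v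
  have hNle : log (N : ℝ) / N ≤ 1 := by
    rw [div_le_one (by positivity)]
    have := Real.log_le_sub_one_of_pos (x := (N : ℝ)) (by positivity)
    linarith
  have a := sum_log_div_primesLE_le N hN1
  have b := le_sum_log_div_primesLE N hN1
  rw [abs_le]
  constructor <;> linarith

/-! ### Sums of reciprocals of primes -/

lemma primesUnder_sdiff_prime_log_div {w y : ℝ} (hw : 1 < w) {p : ℕ}
    (hp : p ∈ primesUnder y \ primesUnder w) :
    1 / (p : ℝ) ≤ (log p / p) / log w := by
  rw [mem_sdiff, mem_primesUnder, mem_primesUnder, not_and] at hp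
  have hwp : w ≤ p := by
    by_contra h
    exact hp.2 (not_le.1 h) hp.1.2
  have hl : 0 < log w := log_pos hw
  have hp0 : (0 : ℝ) < p := by linarith
  rw [le_div_iff₀ hl, div_mul_eq_mul_div, one_mul]
  exact div_le_div_of_nonneg_right (log_le_log (by linarith) hwp) hp0.le

lemma sum_primesUnder_sdiff {w y : ℝ} (h : w ≤ y) (f : ℕ → ℝ) :
    ∑ p ∈ primesUnder y \ primesUnder w, f p
      = ∑ p ∈ primesUnder y, f p - ∑ p ∈ primesUnder w, f p := by
  rw [← sum_sdiff (primesUnder_mono h)]; ring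

lemma sum_inv_primesUnder_sdiff_le {w y : ℝ} (hw : 1 < w) (h : w ≤ y) :
    ∑ p ∈ primesUnder y \ primesUnder w, 1 / (p : ℝ) ≤
      (∑ p ∈ primesUnder y, log p / p - ∑ p ∈ primesUnder w, log p / p) / log w := by
  rw [← sum_primesUnder_sdiff h, sum_div]
  exact sum_le_sum fun p hp => primesUnder_sdiff_prime_log_div hw hp

/-- The sum of the reciprocals of the primes of `[w, w²)` is bounded. -/
lemma sum_inv_primesUnder_sq_sdiff_le {w : ℝ} (hw : 2 ≤ w) :
    ∑ p ∈ primesUnder (w ^ 2) \ primesUnder w, 1 / (p : ℝ) ≤ 17 := by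
  refine (sum_inv_primesUnder_sdiff_le (by linarith) (by nlinarith)).trans ?_
  have hl : 1 / 2 < log w := by
    have := log_le_log (by norm_num) hw
    have := Real.log_two_gt_d9
    linarith
  have a := abs_le.1 (abs_sum_log_div_primesUnder_sub_log_le (y := w) (by linarith))
  have b := abs_le.1 (abs_sum_log_div_primesUnder_sub_log_le (y := w ^ 2) (by nlinarith))
  rw [log_pow] at b
  push_cast at b
  rw [div_le_iff₀ (by linarith)]
  linarith [a.1, b.2]

/-- Partial summation along the points `exp (M + 1)`, phrased as an induction. The last term is the
boundary term; the `- 4` makes its numerator nonpositive by Mertens' first theorem, so that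
enlarging the denominator only increases it. The `8` covers the boundary term at `M = 0`. -/
lemma sum_inv_primesUnder_exp_le (M : ℕ) :
    ∑ p ∈ primesUnder (exp ((M + 1 : ℕ) : ℝ)), 1 / (p : ℝ) ≤
      ∑ p ∈ primesUnder (exp 1), 1 / (p : ℝ) + 8 + (harmonic M : ℝ) +
      (∑ p ∈ primesUnder (exp ((M + 1 : ℕ) : ℝ)), log p / p - (M + 1 : ℕ) - 4) / (M + 1 : ℕ) := by
  induction M with
  | zero =>
    have := abs_le.1 (abs_sum_log_div_primesUnder_sub_log_le (y := exp 1) (by simp))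
    rw [log_exp] at this
    simp
    linarith [this.1]
  | succ M ih =>
    have h1 := sum_inv_primesUnder_sdiff_le (w := exp ((M + 1 : ℕ) : ℝ))
      (y := exp ((M + 1 + 1 : ℕ) : ℝ)) (by rw [one_lt_exp_iff]; positivity)
      (by rw [exp_le_exp]; push_cast; linarith)
    rw [sum_primesUnder_sdiff (by rw [exp_le_exp]; push_cast; linarith), log_exp] at h1
    have hE := abs_le.1 (abs_sum_log_div_primesUnder_sub_log_le (y := exp ((M + 1 + 1 : ℕ) : ℝ))
      (by rw [one_le_exp_iff]; positivity))
    rw [log_exp] at hE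
    rw [harmonic_succ]
    set S := ∑ p ∈ primesUnder (exp ((M + 1 + 1 : ℕ) : ℝ)), log p / p
    set S' := ∑ p ∈ primesUnder (exp ((M + 1 : ℕ) : ℝ)), log p / p
    have h2 : (S - (M + 1 + 1 : ℕ) - 4) / ((M + 1 : ℕ) : ℝ) ≤
        (S - (M + 1 + 1 : ℕ) - 4) / ((M + 1 + 1 : ℕ) : ℝ) := by
      have h3 : 0 ≤ (4 - (S - (M + 1 + 1 : ℕ))) := by linarith [hE.2]
      have := div_le_div_of_nonneg_left h3 (by positivity : (0 : ℝ) < ((M + 1 : ℕ) : ℝ))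
        (by push_cast; linarith : ((M + 1 : ℕ) : ℝ) ≤ ((M + 1 + 1 : ℕ) : ℝ))
      have e1 : ∀ d : ℝ, (S - (M + 1 + 1 : ℕ) - 4) / d = -((4 - (S - (M + 1 + 1 : ℕ))) / d) := by
        intro d; ring
      rw [e1, e1]; linarith
    have e : (S' - (M + 1 : ℕ) - 4) / ((M + 1 : ℕ) : ℝ) + (S - S') / ((M + 1 : ℕ) : ℝ)
        = (S - (M + 1 + 1 : ℕ) - 4) / ((M + 1 : ℕ) : ℝ) + ((M + 1 : ℕ) : ℝ)⁻¹ := by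
      field_simp; push_cast; ring
    push_cast at *
    linarith

/-- Upper half of Mertens' second theorem. -/
theorem exists_sum_inv_primesUnder_le :
    ∃ C : ℝ, ∀ y : ℝ, 2 ≤ y → ∑ p ∈ primesUnder y, 1 / (p : ℝ) ≤ log (log y) + C := by
  refine ⟨∑ p ∈ primesUnder (exp 1), 1 / (p : ℝ) + 8 + 1 + log 3, fun y hy => ?_⟩
  have hl2 := Real.log_two_gt_d9
  have hl : 1 / 2 < log y := by
    have := log_le_log (by norm_num) hy
    linarith
  set M := ⌊log y⌋₊ with hM
  have hM1 : log y < M + 1 := Nat.lt_floor_add_one _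
  have hy1 : y ≤ exp ((M + 1 : ℕ) : ℝ) := by
    rw [← log_le_iff_le_exp (by linarith)]
    push_cast; linarith
  have h1 := sum_le_sum_of_subset_of_nonneg (f := fun p : ℕ => 1 / (p : ℝ)) (primesUnder_mono hy1)
    (fun p _ _ => by positivity)
  have h2 := sum_inv_primesUnder_exp_le M
  have hE := abs_le.1 (abs_sum_log_div_primesUnder_sub_log_le (y := exp ((M + 1 : ℕ) : ℝ))
      (by rw [one_le_exp_iff]; positivity))
  rw [log_exp] at hE
  have h3 : (∑ p ∈ primesUnder (exp ((M + 1 : ℕ) : ℝ)), log p / p - (M + 1 : ℕ) - 4) /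
      ((M + 1 : ℕ) : ℝ) ≤ 0 := div_nonpos_of_nonpos_of_nonneg (by linarith [hE.2]) (by positivity)
  have h4 : (harmonic M : ℝ) ≤ 1 + log (log y) + log 3 := by
    refine (harmonic_le_one_add_log M).trans ?_
    rw [add_assoc, ← log_mul (by linarith) (by norm_num)]
    -- For `M = 0` the convention `log 0 = 0` applies; the summand `log 3` is there because `log y >
    -- 1 / 2` gives `log y * 3 ≥ 1`.
    rcases Nat.eq_zero_or_pos M with h | h
    · rw [h]; simp
      exact log_nonneg (by linarith)
    · have : (M : ℝ) ≤ log y := Nat.floor_le (by linarith)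
      gcongr
      linarith
  linarith

/-! ### Counting integers in residue classes -/

/-- Counting the solutions of a congruence in `[1, N]`. -/
lemma abs_card_modEq_sub_le (N q c : ℕ) (hq : 0 < q) :
    |(#{n ∈ Ioc 0 N | n ≡ c [MOD q]} : ℝ) - N / q| ≤ 1 := by
  have h := Nat.Ioc_filter_modEq_card 0 N hq c
  have hq' : (0 : ℚ) < q := by exact_mod_cast hq
  have hmono : ⌊((0 : ℕ) - c : ℚ) / (q : ℚ)⌋ ≤ ⌊((N : ℚ) - c) / (q : ℚ)⌋ := by
    apply Int.floor_le_floor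
    have : (0 : ℚ) ≤ N := Nat.cast_nonneg N
    push_cast
    gcongr
  rw [max_eq_left (by linarith)] at h
  have h' : ((#{n ∈ Ioc 0 N | n ≡ c [MOD q]} : ℕ) : ℚ) =
      (⌊((N : ℚ) - c) / (q : ℚ)⌋ : ℚ) - (⌊((0 : ℕ) - c : ℚ) / (q : ℚ)⌋ : ℚ) := by
    exact_mod_cast h
  have a1 := Int.floor_le (((N : ℚ) - c) / (q : ℚ))
  have a2 := Int.lt_floor_add_one (((N : ℚ) - c) / (q : ℚ))
  have b1 := Int.floor_le ((((0 : ℕ) : ℚ) - c) / (q : ℚ))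
  have b2 := Int.lt_floor_add_one ((((0 : ℕ) : ℚ) - c) / (q : ℚ))
  have e : ((N : ℚ) - c) / (q : ℚ) - (((0 : ℕ) : ℚ) - c) / (q : ℚ) = (N : ℚ) / q := by
    push_cast; ring
  have key : |((#{n ∈ Ioc 0 N | n ≡ c [MOD q]} : ℕ) : ℚ) - (N : ℚ) / q| ≤ 1 := by
    rw [h', abs_le]
    constructor <;> linarith
  have := (Rat.cast_le (K := ℝ)).2 key
  push_cast at this
  exact this

/-- The auxiliary class `c` modulo `q` makes the induction run: each residue allowed modulo a new
prime is merged into it by the Chinese remainder theorem. -/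
lemma abs_card_residues_sub_le_aux (N : ℕ) (R : ℕ → Finset ℕ) (T : Finset ℕ)
    (hT : ∀ p ∈ T, p.Prime) (hR : ∀ p ∈ T, R p ⊆ range p) :
    ∀ q c : ℕ, 0 < q → (∀ p ∈ T, Nat.Coprime q p) →
    |(#{n ∈ Ioc 0 N | n ≡ c [MOD q] ∧ ∀ p ∈ T, n % p ∈ R p} : ℝ) -
      (∏ p ∈ T, (#(R p) : ℝ)) * (N / (q * ∏ p ∈ T, (p : ℝ)))| ≤ ∏ p ∈ T, (#(R p) : ℝ) := by
  induction T using Finset.induction_on with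
  | empty =>
    intro q c hq _
    simpa using abs_card_modEq_sub_le N q c hq
  | insert p T hp ih =>
    intro q c hq hqp
    have ih := ih (fun p h => hT p (mem_insert_of_mem h)) (fun p h => hR p (mem_insert_of_mem h))
    have hpp := hT p (mem_insert_self _ _)
    have hRp := hR p (mem_insert_self _ _)
    have hco := hqp p (mem_insert_self _ _)
    have hcount : #{n ∈ Ioc 0 N | n ≡ c [MOD q] ∧ ∀ p' ∈ insert p T, n % p' ∈ R p'} =
        ∑ r ∈ R p, #{n ∈ Ioc 0 N | n ≡ (Nat.chineseRemainder hco c r : ℕ) [MOD q * p] ∧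
          ∀ p' ∈ T, n % p' ∈ R p'} := by
      rw [card_eq_sum_card_fiberwise (f := fun n => n % p) (t := R p)]
      · refine sum_congr rfl fun r hr => ?_
        congr 1
        ext n
        have hrp : r < p := mem_range.1 (hRp hr)
        have hcr := (Nat.chineseRemainder hco c r).2
        simp only [mem_filter, forall_mem_insert]
        rw [← Nat.modEq_and_modEq_iff_modEq_mul hco]
        constructor
        · rintro ⟨⟨h1, h2, -, h4⟩, h5⟩
          refine ⟨h1, ⟨h2.trans hcr.1.symm, ?_⟩, h4⟩
          refine Nat.ModEq.trans ?_ hcr.2.symm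
          rw [Nat.ModEq, h5, Nat.mod_eq_of_lt hrp]
        · rintro ⟨h1, ⟨h2, h3⟩, h4⟩
          have h5 : n % p = r := by
            have := h3.trans hcr.2
            rwa [Nat.ModEq, Nat.mod_eq_of_lt hrp] at this
          exact ⟨⟨h1, h2.trans hcr.1, h5 ▸ hr, h4⟩, h5⟩
      · intro n hn
        simp only [coe_filter, Set.mem_ofPred_eq, forall_mem_insert] at hn
        exact hn.2.2.1
    rw [hcount, prod_insert hp, prod_insert hp]
    push_cast
    have hterm : ∀ r ∈ R p, |(#{n ∈ Ioc 0 N |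
        n ≡ (Nat.chineseRemainder hco c r : ℕ) [MOD q * p] ∧ ∀ p' ∈ T, n % p' ∈ R p'} : ℝ) -
        (∏ p ∈ T, (#(R p) : ℝ)) * (N / ((q * p : ℕ) * ∏ p ∈ T, (p : ℝ)))|
          ≤ ∏ p ∈ T, (#(R p) : ℝ) := fun r _ =>
      ih _ _ (Nat.mul_pos hq hpp.pos) fun p' hp' =>
        Nat.Coprime.mul_left (hqp p' (mem_insert_of_mem hp'))
          ((Nat.coprime_primes hpp (hT p' (mem_insert_of_mem hp'))).2
            (fun h => hp (h ▸ hp')))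
    have := (abs_sum_le_sum_abs _ _).trans (sum_le_sum hterm)
    rw [sum_sub_distrib, sum_const, sum_const, nsmul_eq_mul, nsmul_eq_mul] at this
    push_cast at this
    rw [mul_assoc (#(R p) : ℝ), ← mul_assoc (q : ℝ)]
    exact this

/-- Chinese remainder count: the number of `n ∈ [1, N]` whose residues modulo the primes of `T`
lie in prescribed sets. -/
theorem abs_card_residues_sub_le (N : ℕ) (R : ℕ → Finset ℕ) (T : Finset ℕ)
    (hT : ∀ p ∈ T, p.Prime) (hR : ∀ p ∈ T, R p ⊆ range p) :
    |(#{n ∈ Ioc 0 N | ∀ p ∈ T, n % p ∈ R p} : ℝ) -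
      (∏ p ∈ T, (#(R p) : ℝ)) * (N / ∏ p ∈ T, (p : ℝ))| ≤ ∏ p ∈ T, (#(R p) : ℝ) := by
  simpa [Nat.modEq_one] using abs_card_residues_sub_le_aux N R T hT hR 1 0 one_pos (by simp)

/-! ### Multi-affine forms and Bonferroni's inequalities -/

/-- The multi-affine form in the variables `g p`, `p ∈ P`, with coefficients `lam`. -/
def multiAffine (P : Finset ℕ) (lam : Finset ℕ → ℝ) (g : ℕ → ℝ) : ℝ :=
  ∑ T ∈ P.powerset, lam T * ∏ p ∈ T, g p

/-- Brun's truncation of the Möbius function to sets of at most `b` primes. -/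
def truncMoebius (b : ℕ) (T : Finset ℕ) : ℝ := if #T ≤ b then (-1) ^ #T else 0

/-- The indicator function of the sets with `b` elements. -/
def cardIndicator (b : ℕ) (T : Finset ℕ) : ℝ := if #T = b then 1 else 0

/-- The coefficients of a product of two multi-affine forms in disjoint sets of variables. -/
def mulWeight (P Q : Finset ℕ) (lam mu : Finset ℕ → ℝ) (T : Finset ℕ) : ℝ :=
  lam (T ∩ P) * mu (T ∩ Q)

lemma multiAffine_union {P Q : Finset ℕ} (h : Disjoint P Q) (lam mu : Finset ℕ → ℝ) (g : ℕ → ℝ) :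
    multiAffine (P ∪ Q) (mulWeight P Q lam mu) g = multiAffine P lam g * multiAffine Q mu g := by
  rw [multiAffine, multiAffine, multiAffine, sum_mul_sum, ← sum_product']
  symm
  refine sum_nbij' (fun x => x.1 ∪ x.2) (fun T => (T ∩ P, T ∩ Q)) ?_ ?_ ?_ ?_ ?_
  · rintro ⟨A, B⟩ hx
    rw [mem_product, mem_powerset, mem_powerset] at hx
    exact mem_powerset.2 (union_subset_union hx.1 hx.2)
  · intro T _
    rw [mem_product, mem_powerset, mem_powerset]
    exact ⟨inter_subset_right, inter_subset_right⟩
  all_goals try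
    rintro ⟨A, B⟩ hx
    rw [mem_product, mem_powerset, mem_powerset] at hx
    have hAQ : A ∩ Q = ∅ := disjoint_iff_inter_eq_empty.1 (h.mono_left hx.1)
    have hBP : B ∩ P = ∅ := disjoint_iff_inter_eq_empty.1 (h.symm.mono_left hx.2)
    have e1 : (A ∪ B) ∩ P = A := by
      rw [union_inter_distrib_right, hBP, union_empty, inter_eq_left.2 hx.1]
    have e2 : (A ∪ B) ∩ Q = B := by
      rw [union_inter_distrib_right, hAQ, empty_union, inter_eq_left.2 hx.2]
  · simp only [e1, e2]
  · intro T hT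
    rw [mem_powerset] at hT
    simp only [← inter_union_distrib_left]
    exact inter_eq_left.2 hT
  · simp only [mulWeight, e1, e2]
    rw [prod_union (h.mono hx.1 hx.2)]
    ring

lemma abs_mulWeight (P Q : Finset ℕ) (lam mu : Finset ℕ → ℝ) :
    (fun T => |mulWeight P Q lam mu T|) = mulWeight P Q (fun T => |lam T|) (fun T => |mu T|) := by
  ext T; simp [mulWeight, abs_mul]

lemma multiAffine_sub (P : Finset ℕ) (lam mu : Finset ℕ → ℝ) (g : ℕ → ℝ) :
    multiAffine P (fun T => lam T - mu T) g = multiAffine P lam g - multiAffine P mu g := by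
  simp only [multiAffine, sub_mul, sum_sub_distrib]

lemma multiAffine_add (P : Finset ℕ) (lam mu : Finset ℕ → ℝ) (g : ℕ → ℝ) :
    multiAffine P (fun T => lam T + mu T) g = multiAffine P lam g + multiAffine P mu g := by
  simp only [multiAffine, add_mul, sum_add_distrib]

lemma multiAffine_mono {P : Finset ℕ} {lam mu : Finset ℕ → ℝ} {g : ℕ → ℝ}
    (hg : ∀ p ∈ P, 0 ≤ g p) (h : ∀ T, lam T ≤ mu T) :
    multiAffine P lam g ≤ multiAffine P mu g :=
  sum_le_sum fun T hT => mul_le_mul_of_nonneg_right (h T)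
    (prod_nonneg fun p hp => hg p (mem_powerset.1 hT hp))

lemma multiAffine_nonneg {P : Finset ℕ} {lam : Finset ℕ → ℝ} {g : ℕ → ℝ}
    (hg : ∀ p ∈ P, 0 ≤ g p) (h : ∀ T, 0 ≤ lam T) : 0 ≤ multiAffine P lam g :=
  sum_nonneg fun T hT => mul_nonneg (h T) (prod_nonneg fun p hp => hg p (mem_powerset.1 hT hp))

lemma multiAffine_insert {P : Finset ℕ} {p : ℕ} (hp : p ∉ P) (lam : Finset ℕ → ℝ) (g : ℕ → ℝ) :
    multiAffine (insert p P) lam g =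
      multiAffine P lam g + g p * ∑ T ∈ P.powerset, lam (insert p T) * ∏ q ∈ T, g q := by
  rw [multiAffine, sum_powerset_insert hp, multiAffine, mul_sum]
  congr 1
  refine sum_congr rfl fun T hT => ?_
  rw [prod_insert (fun h => hp (mem_powerset.1 hT h))]
  ring

/-- Bonferroni's inequalities. -/
lemma bonferroni (P : Finset ℕ) (g : ℕ → ℝ) (hg : ∀ p ∈ P, 0 ≤ g p ∧ g p ≤ 1) (b : ℕ) :
    0 ≤ (-1) ^ b * (multiAffine P (truncMoebius b) g - ∏ p ∈ P, (1 - g p)) := by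
  induction P using Finset.induction_on generalizing b with
  | empty => simp [multiAffine, truncMoebius]
  | insert p P hp ih =>
    have hgp := hg p (mem_insert_self _ _)
    have ih := ih fun q hq => hg q (mem_insert_of_mem hq)
    rw [multiAffine_insert hp, prod_insert hp]
    have hprod : 0 ≤ ∏ q ∈ P, (1 - g q) :=
      prod_nonneg fun q hq => sub_nonneg.2 (hg q (mem_insert_of_mem hq)).2
    cases b with
    | zero =>
      have : ∑ T ∈ P.powerset, truncMoebius 0 (insert p T) * ∏ q ∈ T, g q = 0 :=
        sum_eq_zero fun T _ => by simp [truncMoebius]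
      rw [this]
      have := ih 0
      simp only [pow_zero, one_mul] at *
      nlinarith [mul_nonneg hgp.1 hprod]
    | succ b =>
      -- Extracting `p` lowers the truncation level by one and flips the sign, so the induction
      -- hypotheses at `b + 1` and `b` combine with the nonnegative weights `1` and `g p`.
      have : ∑ T ∈ P.powerset, truncMoebius (b + 1) (insert p T) * ∏ q ∈ T, g q =
          - multiAffine P (truncMoebius b) g := by
        rw [multiAffine, ← sum_neg_distrib]
        refine sum_congr rfl fun T hT => ?_
        have hpT : p ∉ T := fun h => hp (mem_powerset.1 hT h)
        simp only [truncMoebius, card_insert_of_notMem hpT, add_le_add_iff_right]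
        split_ifs
        · ring
        · ring
      rw [this]
      have h1 := ih (b + 1)
      have h2 := mul_nonneg hgp.1 (ih b)
      have e : (-1 : ℝ) ^ (b + 1) * (multiAffine P (truncMoebius (b + 1)) g +
          g p * -multiAffine P (truncMoebius b) g - (1 - g p) * ∏ q ∈ P, (1 - g q)) =
          (-1 : ℝ) ^ (b + 1) * (multiAffine P (truncMoebius (b + 1)) g - ∏ q ∈ P, (1 - g q)) +
          g p * ((-1) ^ b * (multiAffine P (truncMoebius b) g - ∏ q ∈ P, (1 - g q))) := by ring
      rw [e]
      exact add_nonneg h1 h2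

lemma truncMoebius_succ {b : ℕ} (hb : Even b) :
    truncMoebius (b + 1) = fun T => truncMoebius b T - cardIndicator (b + 1) T := by
  ext T
  rw [truncMoebius, truncMoebius, cardIndicator]
  rcases lt_trichotomy #T (b + 1) with h | h | h
  · simp [h.le, Nat.le_of_lt_succ h, h.ne]
  · simp [h, pow_succ, hb.neg_one_pow]
  · simp [h.not_ge, h.ne', ((Nat.lt_succ_self b).trans h).not_ge]

lemma abs_truncMoebius_add (b : ℕ) (T : Finset ℕ) :
    |truncMoebius b T| + |cardIndicator (b + 1) T| = if #T ≤ b + 1 then 1 else 0 := by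
  rw [truncMoebius, cardIndicator]
  rcases lt_trichotomy #T (b + 1) with h | h | h
  · simp [h.le, Nat.le_of_lt_succ h, h.ne]
  · simp [h]
  · simp [h.not_ge, h.ne', ((Nat.lt_succ_self b).trans h).not_ge]

lemma le_multiAffine_truncMoebius {P : Finset ℕ} {g : ℕ → ℝ} (hg : ∀ p ∈ P, 0 ≤ g p ∧ g p ≤ 1)
    {b : ℕ} (hb : Even b) : ∏ p ∈ P, (1 - g p) ≤ multiAffine P (truncMoebius b) g := by
  have := bonferroni P g hg b
  rw [hb.neg_one_pow] at this
  linarith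

lemma multiAffine_truncMoebius_sub_le {P : Finset ℕ} {g : ℕ → ℝ}
    (hg : ∀ p ∈ P, 0 ≤ g p ∧ g p ≤ 1) {b : ℕ} (hb : Even b) :
    multiAffine P (truncMoebius b) g - multiAffine P (cardIndicator (b + 1)) g ≤
      ∏ p ∈ P, (1 - g p) := by
  have := bonferroni P g hg (b + 1)
  rw [truncMoebius_succ hb, multiAffine_sub, pow_succ, hb.neg_one_pow] at this
  linarith

/-- These are the first two terms of the binomial expansion; the others are nonnegative. -/
lemma pow_succ_add_mul_le_add_pow_succ {S x : ℝ} (hS : 0 ≤ S) (hx : 0 ≤ x) (r : ℕ) :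
    S ^ (r + 1) + (r + 1) * x * S ^ r ≤ (S + x) ^ (r + 1) := by
  induction r with
  | zero => simp
  | succ r ih =>
    have h1 := mul_le_mul_of_nonneg_right ih (add_nonneg hS hx)
    have h2 : 0 ≤ (r + 1) * x * S ^ r * x := by positivity
    have e : (S + x) ^ (r + 1 + 1) = (S + x) ^ (r + 1) * (S + x) := pow_succ _ _
    rw [e]
    push_cast
    have e2 : (S ^ (r + 1) + (r + 1) * x * S ^ r) * (S + x) =
      S ^ (r + 1 + 1) + (r + 1 + 1) * x * S ^ (r + 1) + (r + 1) * x * S ^ r * x := by ring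
    linarith

/-- An elementary symmetric function is at most a power of the sum over a factorial. -/
lemma multiAffine_cardIndicator_le (P : Finset ℕ) (g : ℕ → ℝ) (hg : ∀ p ∈ P, 0 ≤ g p) (r : ℕ) :
    multiAffine P (cardIndicator r) g ≤ (∑ p ∈ P, g p) ^ r / r.factorial := by
  induction P using Finset.induction_on generalizing r with
  | empty =>
    cases r <;> simp [multiAffine, cardIndicator]
  | insert p P hp ih =>
    have hgp := hg p (mem_insert_self _ _)
    have ih := ih fun q hq => hg q (mem_insert_of_mem hq)
    have hS : 0 ≤ ∑ q ∈ P, g q := sum_nonneg fun q hq => hg q (mem_insert_of_mem hq)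
    rw [multiAffine_insert hp, sum_insert hp]
    cases r with
    | zero =>
      have : ∑ T ∈ P.powerset, cardIndicator 0 (insert p T) * ∏ q ∈ T, g q = 0 :=
        sum_eq_zero fun T _ => by simp [cardIndicator]
      rw [this]
      simpa using ih 0
    | succ r =>
      have : ∑ T ∈ P.powerset, cardIndicator (r + 1) (insert p T) * ∏ q ∈ T, g q =
          multiAffine P (cardIndicator r) g := by
        rw [multiAffine]
        refine sum_congr rfl fun T hT => ?_
        have hpT : p ∉ T := fun h => hp (mem_powerset.1 hT h)
        simp only [cardIndicator, card_insert_of_notMem hpT, add_left_inj]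
      rw [this]
      have h1 := ih (r + 1)
      have h2 := mul_le_mul_of_nonneg_left (ih r) hgp
      have h3 := pow_succ_add_mul_le_add_pow_succ hS hgp r
      have hf : (0 : ℝ) < (r + 1).factorial := by exact_mod_cast Nat.factorial_pos _
      have e : (∑ q ∈ P, g q) ^ (r + 1) / (r + 1).factorial +
          g p * ((∑ q ∈ P, g q) ^ r / r.factorial) =
          ((∑ q ∈ P, g q) ^ (r + 1) + (r + 1) * g p * (∑ q ∈ P, g q) ^ r) /
            (r + 1).factorial := by
        rw [Nat.factorial_succ]
        have : (r.factorial : ℝ) ≠ 0 := by exact_mod_cast r.factorial_ne_zero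
        push_cast
        field_simp
      calc _ ≤ _ := add_le_add h1 h2
        _ = _ := e
        _ ≤ _ := by
          rw [add_comm (g p)]
          gcongr

/-- This bounds the total remainder of a truncated layer: every set of at most `m` primes
contributes `c` to the power of its size. -/
lemma multiAffine_card_le_const (P : Finset ℕ) {c : ℝ} (hc : 0 ≤ c) (m : ℕ) :
    multiAffine P (fun T => if #T ≤ m then 1 else 0) (fun _ => c) ≤ (1 + c * #P) ^ m := by
  induction P using Finset.induction_on generalizing m with
  | empty => simp [multiAffine]
  | insert p P hp ih =>
    rw [multiAffine_insert hp, card_insert_of_notMem hp]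
    cases m with
    | zero =>
      have : ∑ T ∈ P.powerset, (if #(insert p T) ≤ 0 then (1 : ℝ) else 0) * ∏ q ∈ T, c = 0 :=
        sum_eq_zero fun T _ => by simp
      rw [this]
      simpa using ih 0
    | succ m =>
      have : ∑ T ∈ P.powerset, (if #(insert p T) ≤ m + 1 then (1 : ℝ) else 0) * ∏ q ∈ T, c =
          multiAffine P (fun T => if #T ≤ m then 1 else 0) (fun _ => c) := by
        rw [multiAffine]
        refine sum_congr rfl fun T hT => ?_
        have hpT : p ∉ T := fun h => hp (mem_powerset.1 hT h)
        simp only [card_insert_of_notMem hpT, add_le_add_iff_right]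
      rw [this]
      have h1 := ih (m + 1)
      have h2 := mul_le_mul_of_nonneg_left (ih m) hc
      calc _ ≤ (1 + c * #P) ^ (m + 1) + c * (1 + c * #P) ^ m := add_le_add h1 h2
        _ = (1 + c * #P) ^ m * (1 + c * (#P + 1 : ℕ)) := by push_cast; ring
        _ ≤ (1 + c * (#P + 1 : ℕ)) ^ m * (1 + c * (#P + 1 : ℕ)) := by
          gcongr; omega
        _ = _ := (pow_succ _ _).symm

/-! ### The Brun–Hooley sieve -/

/-- Upper and lower sieve weights for the set of primes `P` with level of distribution cost `E`
against `κ`, and main terms within a factor `1 ± 2ρ` of the expected one for the density `g₀`. -/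
def HasSieveWeights (g₀ : ℕ → ℝ) (κ : ℝ) (P : Finset ℕ) (ρ E : ℝ) : Prop :=
  ∃ lo up : Finset ℕ → ℝ,
    (∀ g : ℕ → ℝ, (∀ p ∈ P, 0 ≤ g p ∧ g p ≤ 1) →
      multiAffine P lo g ≤ ∏ p ∈ P, (1 - g p) ∧ ∏ p ∈ P, (1 - g p) ≤ multiAffine P up g) ∧
    (1 - 2 * ρ) * ∏ p ∈ P, (1 - g₀ p) ≤ multiAffine P lo g₀ ∧
    multiAffine P up g₀ ≤ (1 + 2 * ρ) * ∏ p ∈ P, (1 - g₀ p) ∧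
    multiAffine P (fun T => |lo T|) (fun _ => κ) ≤ E ∧
    multiAffine P (fun T => |up T|) (fun _ => κ) ≤ E

lemma hasSieveWeights_empty (g₀ : ℕ → ℝ) (κ : ℝ) : HasSieveWeights g₀ κ ∅ 0 1 :=
  ⟨fun _ => 1, fun _ => 1, by simp [multiAffine]⟩

/-- Hooley's device for multiplying lower bounds. Let `U ≥ V_Q` be the Bonferroni upper bound on `Q`
and `e` the next symmetric function, so `V_Q ≥ U - e`. Then `V_P * V_Q ≥ V_P * U - V_P * e ≥ lo * U
- up * e`, where only `U ≥ 0` and `e ≥ 0` are needed. The sign of `lo` is irrelevant. -/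
lemma HasSieveWeights.union {g₀ : ℕ → ℝ} {κ ρ r E : ℝ} {P Q : Finset ℕ}
    (h : HasSieveWeights g₀ κ P ρ E) (hPQ : Disjoint P Q) {b : ℕ} (hb : Even b) (hκ : 0 ≤ κ)
    (hP : ∀ p ∈ P, 0 ≤ g₀ p ∧ g₀ p ≤ 1) (hQ : ∀ p ∈ Q, 0 ≤ g₀ p ∧ g₀ p ≤ 1)
    (hρ : 0 ≤ ρ) (hr : 0 ≤ r) (hρr : 2 * (ρ + r) ≤ 1)
    (hQr : multiAffine Q (cardIndicator (b + 1)) g₀ ≤ r * ∏ p ∈ Q, (1 - g₀ p)) :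
    HasSieveWeights g₀ κ (P ∪ Q) (ρ + r)
      (E * multiAffine Q (fun T => if #T ≤ b + 1 then 1 else 0) (fun _ => κ)) := by
  obtain ⟨lo, up, h1, h2, h3, h4, h5⟩ := h
  have hind : ∀ T, 0 ≤ cardIndicator (b + 1) T := fun T => by
    rw [cardIndicator]; split_ifs <;> norm_num
  have hκ' : ∀ p ∈ Q, 0 ≤ (fun _ : ℕ => κ) p := fun _ _ => hκ
  have hκ'' : ∀ p ∈ P, 0 ≤ (fun _ : ℕ => κ) p := fun _ _ => hκ
  have hcost : multiAffine Q (fun T => if #T ≤ b + 1 then 1 else 0) (fun _ => κ) =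
      multiAffine Q (fun T => |truncMoebius b T|) (fun _ => κ) +
      multiAffine Q (fun T => |cardIndicator (b + 1) T|) (fun _ => κ) := by
    rw [← multiAffine_add]
    simp only [abs_truncMoebius_add]
  have hy0 := multiAffine_nonneg (lam := fun T => |truncMoebius b T|) hκ' (fun T => abs_nonneg _)
  have he0 := multiAffine_nonneg (lam := fun T => |cardIndicator (b + 1) T|) hκ'
    (fun T => abs_nonneg _)
  have hE : 0 ≤ E := (multiAffine_nonneg hκ'' (fun T => abs_nonneg (lo T))).trans h4
  refine ⟨fun T => mulWeight P Q lo (truncMoebius b) T -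
      mulWeight P Q up (cardIndicator (b + 1)) T, mulWeight P Q up (truncMoebius b),
      ?_, ?_, ?_, ?_, ?_⟩
  · intro g hg
    have hgP : ∀ p ∈ P, 0 ≤ g p ∧ g p ≤ 1 := fun p hp => hg p (mem_union_left _ hp)
    have hgQ : ∀ p ∈ Q, 0 ≤ g p ∧ g p ≤ 1 := fun p hp => hg p (mem_union_right _ hp)
    have hVP : 0 ≤ ∏ p ∈ P, (1 - g p) := prod_nonneg fun p hp => sub_nonneg.2 (hgP p hp).2
    have hVQ : 0 ≤ ∏ p ∈ Q, (1 - g p) := prod_nonneg fun p hp => sub_nonneg.2 (hgQ p hp).2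
    obtain ⟨a1, a2⟩ := h1 g hgP
    have a3 := le_multiAffine_truncMoebius hgQ hb
    have a4 := multiAffine_truncMoebius_sub_le hgQ hb
    have a5 := multiAffine_nonneg (fun p hp => (hgQ p hp).1) hind
    rw [multiAffine_sub]
    simp only [multiAffine_union hPQ, prod_union hPQ]
    constructor
    · have b1 := mul_le_mul_of_nonneg_right a1 (hVQ.trans a3)
      have b2 := mul_le_mul_of_nonneg_left a4 hVP
      have b3 := mul_le_mul_of_nonneg_right a2 a5
      linarith
    · exact mul_le_mul a2 a3 hVQ (hVP.trans a2)
  · have hVP : 0 ≤ ∏ p ∈ P, (1 - g₀ p) := prod_nonneg fun p hp => sub_nonneg.2 (hP p hp).2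
    have hVQ : 0 ≤ ∏ p ∈ Q, (1 - g₀ p) := prod_nonneg fun p hp => sub_nonneg.2 (hQ p hp).2
    have a3 := le_multiAffine_truncMoebius hQ hb
    have a5 := multiAffine_nonneg (fun p hp => (hQ p hp).1) hind
    rw [multiAffine_sub, multiAffine_union hPQ, multiAffine_union hPQ, prod_union hPQ]
    have b0 : 0 ≤ (1 - 2 * ρ) * ∏ p ∈ P, (1 - g₀ p) := mul_nonneg (by linarith) hVP
    have b1 := mul_le_mul h2 a3 hVQ (b0.trans h2)
    -- As `2 * ρ ≤ 1`, the upper weights lose at most a factor `2`; this is why errors enter as `2 *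
    -- ρ`.
    have b2 : multiAffine P up g₀ * multiAffine Q (cardIndicator (b + 1)) g₀ ≤
        (2 * ∏ p ∈ P, (1 - g₀ p)) * (r * ∏ p ∈ Q, (1 - g₀ p)) := by
      refine mul_le_mul (h3.trans ?_) hQr a5 (by positivity)
      exact mul_le_mul_of_nonneg_right (by linarith) hVP
    nlinarith
  · have hVP : 0 ≤ ∏ p ∈ P, (1 - g₀ p) := prod_nonneg fun p hp => sub_nonneg.2 (hP p hp).2
    have hVQ : 0 ≤ ∏ p ∈ Q, (1 - g₀ p) := prod_nonneg fun p hp => sub_nonneg.2 (hQ p hp).2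
    have a3 := le_multiAffine_truncMoebius hQ hb
    have a4 := multiAffine_truncMoebius_sub_le hQ hb
    rw [multiAffine_union hPQ, prod_union hPQ]
    calc _ ≤ ((1 + 2 * ρ) * ∏ p ∈ P, (1 - g₀ p)) * ((1 + r) * ∏ p ∈ Q, (1 - g₀ p)) :=
          mul_le_mul h3 (by linarith) (hVQ.trans a3) (mul_nonneg (by linarith) hVP)
      _ = ((1 + 2 * ρ) * (1 + r)) * ((∏ p ∈ P, (1 - g₀ p)) * ∏ p ∈ Q, (1 - g₀ p)) := by ring
      _ ≤ _ := mul_le_mul_of_nonneg_right (by nlinarith) (mul_nonneg hVP hVQ)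
  · calc _ ≤ multiAffine (P ∪ Q) (fun T => |mulWeight P Q lo (truncMoebius b) T| +
          |mulWeight P Q up (cardIndicator (b + 1)) T|) (fun _ => κ) :=
          multiAffine_mono (fun _ _ => hκ) fun T => abs_sub _ _
      _ ≤ _ := by
          rw [multiAffine_add, abs_mulWeight, abs_mulWeight, multiAffine_union hPQ,
            multiAffine_union hPQ, hcost, mul_add]
          gcongr
  · rw [abs_mulWeight, multiAffine_union hPQ, hcost, mul_add]
    have := mul_nonneg hE he0
    have := mul_le_mul_of_nonneg_right h5 hy0
    linarith

lemma neg_div_one_sub_le_log {u : ℝ} (h : u < 1) : -(u / (1 - u)) ≤ log (1 - u) := by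
  have h0 : 0 < 1 - u := by linarith
  have := Real.one_sub_inv_le_log_of_pos h0
  have e : 1 - (1 - u)⁻¹ = -(u / (1 - u)) := by field_simp; ring
  linarith

lemma exp_neg_two_mul_sum_le_prod {P : Finset ℕ} {g : ℕ → ℝ}
    (hg : ∀ p ∈ P, 0 ≤ g p ∧ g p ≤ 1 / 2) :
    exp (-(2 * ∑ p ∈ P, g p)) ≤ ∏ p ∈ P, (1 - g p) := by
  rw [mul_sum, ← sum_neg_distrib, exp_sum]
  refine prod_le_prod (fun p _ => (exp_pos _).le) fun p hp => ?_
  obtain ⟨h0, h1⟩ := hg p hp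
  rw [← le_log_iff_exp_le (by linarith)]
  refine le_trans ?_ (neg_div_one_sub_le_log (by linarith))
  rw [neg_le_neg_iff, div_le_iff₀ (by linarith)]
  nlinarith

lemma exp_neg_sum_add_sq_le_prod {P : Finset ℕ} {g : ℕ → ℝ}
    (hg : ∀ p ∈ P, 0 ≤ g p ∧ g p ≤ 1 / 2) :
    exp (-(∑ p ∈ P, g p + 2 * ∑ p ∈ P, g p ^ 2)) ≤ ∏ p ∈ P, (1 - g p) := by
  rw [mul_sum, ← sum_add_distrib, ← sum_neg_distrib, exp_sum]
  refine prod_le_prod (fun p _ => (exp_pos _).le) fun p hp => ?_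
  obtain ⟨h0, h1⟩ := hg p hp
  rw [← le_log_iff_exp_le (by linarith)]
  refine le_trans ?_ (neg_div_one_sub_le_log (by linarith))
  rw [neg_le_neg_iff, div_le_iff₀ (by linarith)]
  nlinarith [sq_nonneg (g p), mul_nonneg (sq_nonneg (g p)) (by linarith : 0 ≤ 1 - 2 * g p)]

lemma density_bounds {k p : ℕ} (h : 2 * k < p) : 0 ≤ (k : ℝ) / p ∧ (k : ℝ) / p ≤ 1 / 2 := by
  have hp : (0 : ℝ) < p := by exact_mod_cast (by omega : 0 < p)
  refine ⟨by positivity, ?_⟩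
  rw [div_le_iff₀ hp]
  have : (2 : ℝ) * k < p := by exact_mod_cast h
  linarith

lemma HasSieveWeights.mono {g₀ : ℕ → ℝ} {κ ρ E E' : ℝ} {P : Finset ℕ}
    (h : HasSieveWeights g₀ κ P ρ E) (hE : E ≤ E') : HasSieveWeights g₀ κ P ρ E' := by
  obtain ⟨lo, up, h1, h2, h3, h4, h5⟩ := h
  exact ⟨lo, up, h1, h2, h3, h4.trans hE, h5.trans hE⟩

lemma sum_inv_le_of_log_mem {P : Finset ℕ} {l : ℝ}
    (hP : ∀ p ∈ P, p.Prime ∧ l ≤ log p ∧ log p < 2 * l) : ∑ p ∈ P, 1 / (p : ℝ) ≤ 17 := by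
  have hsq : exp l ^ 2 = exp (2 * l) := by rw [← exp_nat_mul]; norm_num
  rcases le_or_gt 2 (exp l) with h | h
  · refine le_trans (sum_le_sum_of_subset_of_nonneg ?_ fun _ _ _ => by positivity)
      (sum_inv_primesUnder_sq_sdiff_le h)
    intro p hp
    obtain ⟨h1, h2, h3⟩ := hP p hp
    have hp0 : (0 : ℝ) < p := by exact_mod_cast h1.pos
    rw [mem_sdiff, mem_primesUnder, mem_primesUnder, hsq, not_and_or, not_lt]
    exact ⟨⟨(log_lt_iff_lt_exp hp0).1 h3, h1⟩, Or.inl ((le_log_iff_exp_le hp0).1 h2)⟩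
  · have hsub : P ⊆ {2, 3} := by
      intro p hp
      obtain ⟨h1, h2, h3⟩ := hP p hp
      have hp0 : (0 : ℝ) < p := by exact_mod_cast h1.pos
      have h4 := (log_lt_iff_lt_exp hp0).1 h3
      rw [← hsq] at h4
      have h5 : (p : ℝ) < 4 := by nlinarith [exp_pos l]
      have h6 : p < 4 := by exact_mod_cast h5
      have := h1.two_le
      rw [mem_insert, mem_singleton]
      omega
    refine (sum_le_sum_of_subset_of_nonneg hsub fun _ _ _ => by positivity).trans ?_
    norm_num

/-- If `P` is nonempty, then `2 * k < p < u` for some `p ∈ P`, so `k ≤ u / 2`: the dimension is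
absorbed and the bound does not involve `k`. -/
lemma one_add_mul_card_le {k : ℕ} {P : Finset ℕ} {u : ℝ} (hu : 1 ≤ u)
    (hP : ∀ p ∈ P, p.Prime ∧ 2 * k < p ∧ (p : ℝ) < u) : 1 + (k : ℝ) * #P ≤ u ^ 2 := by
  rcases P.eq_empty_or_nonempty with rfl | ⟨p, hp⟩
  · rw [card_empty, Nat.cast_zero, mul_zero, add_zero]
    exact one_le_pow₀ hu
  · obtain ⟨h1, h2, h3⟩ := hP p hp
    have h4 : (2 : ℝ) ≤ p := by exact_mod_cast h1.two_le
    have h5 : (2 : ℝ) * k ≤ p := by exact_mod_cast h2.le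
    have hc : (#P : ℝ) ≤ u := by
      have hsub : P ⊆ Ioc 0 ⌊u⌋₊ := fun q hq => by
        obtain ⟨a, -, c⟩ := hP q hq
        exact mem_Ioc.2 ⟨a.pos, Nat.le_floor c.le⟩
      have := card_le_card hsub
      rw [Nat.card_Ioc, Nat.sub_zero] at this
      exact le_trans (by exact_mod_cast this) (Nat.floor_le (by linarith))
    have : (k : ℝ) * #P ≤ u / 2 * u :=
      mul_le_mul (by linarith) hc (by positivity) (by linarith)
    nlinarith

lemma exists_pow_div_factorial_le (L : ℝ) {ε : ℝ} (hε : 0 < ε) :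
    ∃ b : ℕ, ∀ m, b ≤ m → L ^ m / m.factorial ≤ ε / 2 ^ m := by
  have h := FloorSemiring.tendsto_pow_div_factorial_atTop (2 * L)
  obtain ⟨b, hb⟩ := Filter.eventually_atTop.1 (h.eventually_lt_const hε)
  refine ⟨b, fun m hm => ?_⟩
  have := (hb m hm).le
  rw [mul_pow, mul_div_assoc] at this
  rw [le_div_iff₀ (by positivity)]
  linarith

/-- The layer `l / 2 ^ (t + 1) ≤ log p < l / 2 ^ t` is truncated at `2 * (t + b)`. Its reciprocal
sum is bounded independently of `t`, so the factorial makes the relative error at most `1 / (8 * 2 ^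
t)`; these errors sum to `1 / 4 * (1 - 1 / 2 ^ t)`. The cost exponent of the layer is `l * (4 * t +
4 * b + 2) / 2 ^ t`, whose partial sums are the stated closed form. -/
lemma hasSieveWeights_filter_log {k b : ℕ} {P : Finset ℕ} {l : ℝ} (hl : 0 ≤ l)
    (hP : ∀ p ∈ P, p.Prime ∧ 2 * k < p ∧ log p < l)
    (hb : ∀ m, b ≤ m → (17 * k : ℝ) ^ m / m.factorial ≤ exp (-(2 * (17 * k))) / 8 / 2 ^ m)
    (t : ℕ) :
    HasSieveWeights (fun p => k / p) k (P.filter fun p : ℕ => l / 2 ^ t ≤ log (p : ℝ)) (1 / 4 * (1 - 1 / 2 ^ t))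
      (exp (l * (8 + 2 * (4 * b + 2) - (8 * t + 8 + 2 * (4 * b + 2)) / 2 ^ t))) := by
  induction t with
  | zero =>
    have : (P.filter fun p : ℕ => l / 2 ^ 0 ≤ log (p : ℝ)) = ∅ := by
      refine filter_eq_empty_iff.2 fun p hp => ?_
      simpa using (hP p hp).2.2
    rw [this]
    simpa using hasSieveWeights_empty (fun p => (k : ℝ) / p) k
  | succ t ih =>
    set Q := (P.filter fun p : ℕ => l / 2 ^ (t + 1) ≤ log (p : ℝ) ∧ log (p : ℝ) < l / 2 ^ t) with hQ
    have hpow : (0 : ℝ) < 2 ^ t := by positivity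
    have hpow1 : (1 : ℝ) ≤ 2 ^ t := one_le_pow₀ (by norm_num)
    have hunion : (P.filter fun p : ℕ => l / 2 ^ (t + 1) ≤ log (p : ℝ)) = (P.filter fun p : ℕ => l / 2 ^ t ≤ log (p : ℝ)) ∪ Q := by
      have : l / 2 ^ (t + 1) ≤ l / 2 ^ t :=
        div_le_div_of_nonneg_left hl hpow (pow_le_pow_right₀ (by norm_num) (by omega))
      rw [hQ, ← filter_or]
      refine filter_congr fun p _ => ?_
      constructor
      · intro h
        rcases le_or_gt (l / 2 ^ t) (log p) with h' | h'
        · exact Or.inl h'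
        · exact Or.inr ⟨h, h'⟩
      · rintro (h | h)
        · exact this.trans h
        · exact h.1
    have hdisj : Disjoint (P.filter fun p : ℕ => l / 2 ^ t ≤ log (p : ℝ)) Q :=
      disjoint_filter.2 fun p _ h h' => h'.2.not_ge h
    have hg : ∀ p ∈ P, 0 ≤ (k : ℝ) / p ∧ (k : ℝ) / p ≤ 1 / 2 := fun p hp =>
      density_bounds (hP p hp).2.1
    have hQP : Q ⊆ P := filter_subset _ _
    have hsum : ∑ p ∈ Q, (k : ℝ) / p ≤ 17 * k := by
      have := sum_inv_le_of_log_mem (P := Q) (l := l / 2 ^ (t + 1)) fun p hp => by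
        rw [hQ, mem_filter] at hp
        refine ⟨(hP p hp.1).1, hp.2.1, hp.2.2.trans_eq ?_⟩
        rw [pow_succ]; field_simp
      have e : ∑ p ∈ Q, (k : ℝ) / p = k * ∑ p ∈ Q, 1 / (p : ℝ) := by
        rw [mul_sum]; exact sum_congr rfl fun p _ => by ring
      rw [e]
      have hk : (0 : ℝ) ≤ k := Nat.cast_nonneg k
      nlinarith
    have hQr : multiAffine Q (cardIndicator (2 * (t + b) + 1)) (fun p => (k : ℝ) / p) ≤
        1 / (8 * 2 ^ t) * ∏ p ∈ Q, (1 - (k : ℝ) / p) := by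
      have h1 := multiAffine_cardIndicator_le Q (fun p => (k : ℝ) / p)
        (fun p hp => (hg p (hQP hp)).1) (2 * (t + b) + 1)
      have h2 : (∑ p ∈ Q, (k : ℝ) / p) ^ (2 * (t + b) + 1) / (2 * (t + b) + 1).factorial ≤
          (17 * k : ℝ) ^ (2 * (t + b) + 1) / (2 * (t + b) + 1).factorial := by
        have : 0 ≤ ∑ p ∈ Q, (k : ℝ) / p := sum_nonneg fun p hp => (hg p (hQP hp)).1
        gcongr
      have h3 := hb (2 * (t + b) + 1) (by omega)
      have h4 : exp (-(2 * (17 * k))) ≤ ∏ p ∈ Q, (1 - (k : ℝ) / p) := by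
        refine le_trans ?_ (exp_neg_two_mul_sum_le_prod fun p hp => hg p (hQP hp))
        gcongr
      have h5 : exp (-(2 * (17 * k : ℝ))) / 8 / 2 ^ (2 * (t + b) + 1) ≤
          exp (-(2 * (17 * k : ℝ))) / 8 / 2 ^ t := by
        apply div_le_div_of_nonneg_left (by positivity) hpow
        exact pow_le_pow_right₀ (by norm_num) (by omega)
      calc _ ≤ exp (-(2 * (17 * k : ℝ))) / 8 / 2 ^ t := h1.trans (h2.trans (h3.trans h5))
        _ = 1 / (8 * 2 ^ t) * exp (-(2 * (17 * k : ℝ))) := by field_simp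
        _ ≤ _ := by gcongr
    have hcost : multiAffine Q (fun T => if #T ≤ 2 * (t + b) + 1 then 1 else 0) (fun _ => (k : ℝ))
        ≤ exp (l / 2 ^ t * (2 * (2 * (t + b) + 1))) := by
      refine (multiAffine_card_le_const Q (Nat.cast_nonneg k) _).trans ?_
      have h1 : 1 + (k : ℝ) * #Q ≤ exp (l / 2 ^ t) ^ 2 := by
        refine one_add_mul_card_le (one_le_exp (by positivity)) fun p hp => ?_
        rw [hQ, mem_filter] at hp
        have hp' := hP p hp.1
        refine ⟨hp'.1, hp'.2.1, ?_⟩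
        rw [← log_lt_iff_lt_exp (by exact_mod_cast hp'.1.pos)]
        exact hp.2.2
      calc _ ≤ (exp (l / 2 ^ t) ^ 2) ^ (2 * (t + b) + 1) := by gcongr
        _ = _ := by
          rw [← pow_mul, ← exp_nat_mul]
          congr 1
          push_cast; ring
    have hrho : (1 : ℝ) / 2 ^ t ≤ 1 := by rw [div_le_one hpow]; exact hpow1
    have hrho0 : (0 : ℝ) ≤ 1 / 2 ^ t := by positivity
    have hr0 : (1 : ℝ) / (8 * 2 ^ t) = 1 / 8 * (1 / 2 ^ t) := by field_simp
    have := (ih.union hdisj (b := 2 * (t + b)) (r := 1 / (8 * 2 ^ t)) (even_two_mul _)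
      (Nat.cast_nonneg k)
      (fun p hp => ⟨(hg p (filter_subset _ _ hp)).1,
        (hg p (filter_subset _ _ hp)).2.trans (by norm_num)⟩)
      (fun p hp => ⟨(hg p (hQP hp)).1, (hg p (hQP hp)).2.trans (by norm_num)⟩)
      (by linarith) (by positivity) (by rw [hr0]; linarith) hQr).mono
      (mul_le_mul_of_nonneg_left hcost (exp_pos _).le)
    rw [hunion]
    convert this using 1
    · rw [pow_succ]; field_simp; ring
    · rw [← exp_add]
      congr 1
      rw [pow_succ]
      push_cast
      field_simp
      ring

/-- Lower-bound sieve weights of dimension `k` (the Brun–Hooley sieve): if `P` consists of primes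
below `y`, then a level of distribution that is a fixed power of `y` is enough to keep half of
the expected main term. -/
theorem exists_lower_sieve_weights (k : ℕ) :
    ∃ B : ℕ, ∀ y : ℝ, 1 ≤ y → ∀ P : Finset ℕ, (∀ p ∈ P, p.Prime ∧ 2 * k < p ∧ (p : ℝ) < y) →
      ∃ lam : Finset ℕ → ℝ,
        (∀ g : ℕ → ℝ, (∀ p ∈ P, 0 ≤ g p ∧ g p ≤ 1) →
          multiAffine P lam g ≤ ∏ p ∈ P, (1 - g p)) ∧
        1 / 2 * ∏ p ∈ P, (1 - (k : ℝ) / p) ≤ multiAffine P lam (fun p => k / p) ∧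
        multiAffine P (fun T => |lam T|) (fun _ => k) ≤ y ^ B := by
  obtain ⟨b, hb⟩ := exists_pow_div_factorial_le (17 * k)
    (ε := exp (-(2 * (17 * k))) / 8) (by positivity)
  refine ⟨8 + 2 * (4 * b + 2), fun y hy P hP => ?_⟩
  have hl : 0 ≤ log y := log_nonneg hy
  -- With `log y / 2 ^ t` below `log 2`, the first `t` layers exhaust all of `P`.
  obtain ⟨t, ht⟩ := pow_unbounded_of_one_lt (log y / log 2) (by norm_num : (1 : ℝ) < 2)
  have hl2 : 0 < log 2 := log_pos (by norm_num)
  have hfil : (P.filter fun p : ℕ => log y / 2 ^ t ≤ log (p : ℝ)) = P := by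
    refine filter_true_of_mem fun p hp => ?_
    have h2 : log 2 ≤ log p := log_le_log (by norm_num) (by exact_mod_cast (hP p hp).1.two_le)
    refine le_trans ?_ h2
    rw [div_lt_iff₀ hl2] at ht
    rw [div_le_iff₀ (by positivity)]
    linarith
  obtain ⟨lo, up, h1, h2, -, h4, -⟩ := hasSieveWeights_filter_log (k := k) hl
    (fun p hp => ⟨(hP p hp).1, (hP p hp).2.1,
      log_lt_log (by exact_mod_cast (hP p hp).1.pos) (hP p hp).2.2⟩) hb t
  rw [hfil] at h1 h2 h4
  refine ⟨lo, fun g hg => (h1 g hg).1, le_trans ?_ h2, h4.trans ?_⟩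
  · have hV : 0 ≤ ∏ p ∈ P, (1 - (k : ℝ) / p) := prod_nonneg fun p hp => by
      have := density_bounds (hP p hp).2.1
      linarith
    refine mul_le_mul_of_nonneg_right ?_ hV
    have : (0 : ℝ) ≤ 1 / 2 ^ t := by positivity
    linarith
  · rw [← Real.exp_log (by linarith : (0 : ℝ) < y), ← exp_nat_mul, Real.exp_log (by linarith),
      exp_le_exp, mul_comm]
    refine mul_le_mul_of_nonneg_right ?_ hl
    have : (0 : ℝ) ≤ (8 * t + 8 + 2 * (4 * b + 2)) / 2 ^ t := by positivity
    push_cast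
    linarith

/-! ### Sieve density, prime sums avoiding `S`, and sieving residue classes -/

/-- The expected density of a sieve of dimension `k`. -/
theorem exists_div_log_pow_le_prod (k : ℕ) :
    ∃ c : ℝ, 0 < c ∧ ∀ y : ℝ, 2 ≤ y → ∀ P : Finset ℕ,
      (∀ p ∈ P, p.Prime ∧ 2 * k < p ∧ (p : ℝ) < y) →
      c / log y ^ k ≤ ∏ p ∈ P, (1 - (k : ℝ) / p) := by
  obtain ⟨C, hC⟩ := exists_sum_inv_primesUnder_le
  refine ⟨exp (-(k * C + 4 * k ^ 2)), exp_pos _, fun y hy P hP => ?_⟩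
  have hl : 0 < log y := log_pos (by linarith)
  refine le_trans ?_ (exp_neg_sum_add_sq_le_prod fun p hp => density_bounds (hP p hp).2.1)
  have h1 : ∑ p ∈ P, (k : ℝ) / p ≤ k * (log (log y) + C) := by
    have e : ∑ p ∈ P, (k : ℝ) / p = k * ∑ p ∈ P, 1 / (p : ℝ) := by
      rw [mul_sum]; exact sum_congr rfl fun p _ => by ring
    rw [e]
    refine mul_le_mul_of_nonneg_left (le_trans ?_ (hC y hy)) (Nat.cast_nonneg k)
    refine sum_le_sum_of_subset_of_nonneg (fun p hp => ?_) fun _ _ _ => by positivity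
    exact mem_primesUnder.2 ⟨(hP p hp).2.2, (hP p hp).1⟩
  have h2 : ∑ p ∈ P, ((k : ℝ) / p) ^ 2 ≤ k ^ 2 * 2 := by
    have e : ∑ p ∈ P, ((k : ℝ) / p) ^ 2 = k ^ 2 * ∑ p ∈ P, ((p : ℝ) ^ 2)⁻¹ := by
      rw [mul_sum]; exact sum_congr rfl fun p _ => by rw [div_pow, div_eq_mul_inv]
    rw [e]
    refine mul_le_mul_of_nonneg_left ?_ (by positivity)
    have := sum_Ioo_inv_sq_le (α := ℝ) 0 ⌈y⌉₊
    refine le_trans (sum_le_sum_of_subset_of_nonneg (fun p hp => ?_) fun _ _ _ => by positivity)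
      (this.trans (by norm_num))
    exact mem_Ioo.2 ⟨(hP p hp).1.pos, Nat.lt_ceil.2 (hP p hp).2.2⟩
  have e : log y ^ k = exp (k * log (log y)) := by
    rw [exp_nat_mul, exp_log hl]
  rw [e, ← exp_sub, exp_le_exp]
  linarith

/-- The reciprocals of the primes of `[w, w ^ A)` outside a set of bounded size have a sum bounded
from below, once `A` is large. -/
theorem quarter_le_sum_inv_primesUnder_sdiff {w : ℝ} (hw : 2 ≤ w) (S : Finset ℕ) {A : ℕ}
    (hA : 4 * (#S + 10) ≤ A) :
    1 / 4 ≤ ∑ p ∈ (primesUnder (w ^ A) \ primesUnder w) \ S, 1 / (p : ℝ) := by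
  have hA' : 4 * ((#S : ℝ) + 10) ≤ A := by exact_mod_cast hA
  have hs : (0 : ℝ) ≤ #S := Nat.cast_nonneg _
  have hl : 1 / 2 < log w := by
    have := log_le_log (by norm_num) hw
    have := Real.log_two_gt_d9
    linarith
  have hA1 : (1 : ℝ) ≤ A := by linarith
  have hwA : w ≤ w ^ A := le_self_pow₀ (by linarith) (by omega)
  have a := abs_le.1 (abs_sum_log_div_primesUnder_sub_log_le (y := w) (by linarith))
  have b := abs_le.1 (abs_sum_log_div_primesUnder_sub_log_le (y := w ^ A) (by linarith))
  rw [log_pow] at b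
  set D := primesUnder (w ^ A) \ primesUnder w with hD
  have h1 : ((A : ℝ) - 1) * log w - 8 ≤ ∑ p ∈ D, log p / p := by
    rw [hD, sum_primesUnder_sdiff hwA]
    linarith [a.2, b.1]
  -- Whatever the primes of `S` are, deleting one costs at most `1`; hence only the cardinality of
  -- `S` matters.
  have h2 : ∑ p ∈ D ∩ S, log (p : ℝ) / p ≤ #S := by
    have : ∀ p ∈ D ∩ S, log (p : ℝ) / p ≤ 1 := fun p hp => by
      have hp' := (mem_primesUnder.1 (mem_sdiff.1 (mem_inter.1 hp).1).1).2
      have hp0 : (0 : ℝ) < p := by exact_mod_cast hp'.pos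
      rw [div_le_one hp0]
      linarith [Real.log_le_sub_one_of_pos hp0]
    refine (sum_le_card_nsmul _ _ _ this).trans ?_
    rw [nsmul_eq_mul, mul_one]
    exact_mod_cast card_le_card inter_subset_right
  have h3 : ∑ p ∈ D \ S, log (p : ℝ) / p = ∑ p ∈ D, log (p : ℝ) / p -
      ∑ p ∈ D ∩ S, log (p : ℝ) / p := by
    rw [← sum_inter_add_sum_sdiff D S]; ring
  have h4 : (∑ p ∈ D \ S, log (p : ℝ) / p) / (A * log w) ≤ ∑ p ∈ D \ S, 1 / (p : ℝ) := by
    rw [sum_div]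
    refine sum_le_sum fun p hp => ?_
    have hp' := mem_primesUnder.1 (mem_sdiff.1 (mem_sdiff.1 hp).1).1
    have hp0 : (0 : ℝ) < p := by exact_mod_cast hp'.2.pos
    have : log p ≤ A * log w := by
      rw [← log_pow]; exact log_le_log hp0 hp'.1.le
    rw [div_right_comm]
    refine div_le_div_of_nonneg_right ?_ hp0.le
    rw [div_le_one (by positivity)]
    exact this
  refine le_trans ?_ h4
  rw [le_div_iff₀ (by positivity), h3]
  have : (3 / 4 * (A : ℝ) - 1) * (1 / 2) ≤ (3 / 4 * (A : ℝ) - 1) * log w :=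
    mul_le_mul_of_nonneg_left hl.le (by linarith)
  linarith

/-- The lower-bound sieve of dimension `k` for integers in residue classes: `n ∈ [1, N]` lies in a
prescribed class modulo each prime of `T` and avoids `k` classes modulo each prime of `P`. -/
theorem exists_card_residues_lower_bound (k : ℕ) :
    ∃ B : ℕ, ∀ y : ℝ, 1 ≤ y → ∀ P : Finset ℕ, (∀ p ∈ P, p.Prime ∧ 2 * k < p ∧ (p : ℝ) < y) →
      ∀ T : Finset ℕ, (∀ p ∈ T, p.Prime) → Disjoint T P →
      ∀ R : ℕ → Finset ℕ, (∀ p, p.Prime → R p ⊆ range p) → (∀ p ∈ P, #(R p) = k) →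
        (∀ p ∈ T, #(R p) = 1) → ∀ N : ℕ,
        N / (∏ p ∈ T, (p : ℝ)) * (1 / 2 * ∏ p ∈ P, (1 - (k : ℝ) / p)) - y ^ B ≤
          #{n ∈ Ioc 0 N | (∀ p ∈ T, n % p ∈ R p) ∧ ∀ p ∈ P, n % p ∉ R p} := by
  obtain ⟨B, hB⟩ := exists_lower_sieve_weights k
  refine ⟨B, fun y hy P hP T hT hTP R hR hRP hRT N => ?_⟩
  obtain ⟨lam, h1, h2, h3⟩ := hB y hy P hP
  set A := {n ∈ Ioc 0 N | ∀ p ∈ T, n % p ∈ R p} with hA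
  have hcount : ∑ n ∈ A, ∏ p ∈ P, (1 - if n % p ∈ R p then (1 : ℝ) else 0) =
      #{n ∈ Ioc 0 N | (∀ p ∈ T, n % p ∈ R p) ∧ ∀ p ∈ P, n % p ∉ R p} := by
    rw [← filter_filter, card_filter]
    push_cast
    refine sum_congr rfl fun n _ => ?_
    split_ifs with h
    · exact prod_eq_one fun p hp => by simp [h p hp]
    · push Not at h
      obtain ⟨p, hp, h⟩ := h
      exact prod_eq_zero hp (by simp [h])
  rw [← hcount]
  have hlow : ∑ n ∈ A, multiAffine P lam (fun p => if n % p ∈ R p then (1 : ℝ) else 0) ≤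
      ∑ n ∈ A, ∏ p ∈ P, (1 - if n % p ∈ R p then (1 : ℝ) else 0) :=
    sum_le_sum fun n _ => h1 _ fun p _ => by split_ifs <;> norm_num
  refine le_trans ?_ hlow
  -- Evaluated at indicators, the product over `U` detects the `n` in a forbidden class modulo every
  -- prime of `U`; these are counted by the Chinese remainder theorem.
  have hswap : ∑ n ∈ A, multiAffine P lam (fun p => if n % p ∈ R p then (1 : ℝ) else 0) =
      ∑ U ∈ P.powerset, lam U * (#{n ∈ Ioc 0 N | ∀ p ∈ T ∪ U, n % p ∈ R p} : ℝ) := by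
    simp only [multiAffine]
    rw [sum_comm]
    refine sum_congr rfl fun U _ => ?_
    rw [← mul_sum]
    congr 1
    simp only [forall_mem_union]
    rw [← filter_filter, card_filter]
    push_cast
    refine sum_congr rfl fun n _ => ?_
    split_ifs with h
    · exact prod_eq_one fun p hp => by simp [h p hp]
    · push Not at h
      obtain ⟨p, hp, h⟩ := h
      exact prod_eq_zero hp (by simp [h])
  rw [hswap]
  have hterm : ∀ U ∈ P.powerset,
      N / (∏ p ∈ T, (p : ℝ)) * (lam U * ∏ p ∈ U, (k : ℝ) / p) - |lam U| * ∏ p ∈ U, (k : ℝ) ≤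
        lam U * (#{n ∈ Ioc 0 N | ∀ p ∈ T ∪ U, n % p ∈ R p} : ℝ) := by
    intro U hU
    rw [mem_powerset] at hU
    have hpr : ∀ p ∈ T ∪ U, p.Prime := fun p hp => by
      rcases mem_union.1 hp with h | h
      · exact hT p h
      · exact (hP p (hU h)).1
    have h4 := abs_card_residues_sub_le N R (T ∪ U) hpr (fun p hp => hR p (hpr p hp))
    have hd : Disjoint T U := hTP.mono_right hU
    have hcard : ∏ p ∈ T ∪ U, (#(R p) : ℝ) = ∏ p ∈ U, (k : ℝ) := by
      rw [prod_union hd, prod_eq_one (fun p hp => by rw [hRT p hp, Nat.cast_one]), one_mul]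
      exact prod_congr rfl fun p hp => by rw [hRP p (hU hp)]
    rw [hcard, prod_union hd] at h4
    have h5 := mul_le_mul_of_nonneg_left h4 (abs_nonneg (lam U))
    rw [← abs_mul, mul_sub] at h5
    have h6 := (abs_le.1 h5).1
    have e : lam U * ((∏ p ∈ U, (k : ℝ)) * (N / ((∏ p ∈ T, (p : ℝ)) * ∏ p ∈ U, (p : ℝ)))) =
        N / (∏ p ∈ T, (p : ℝ)) * (lam U * ∏ p ∈ U, (k : ℝ) / p) := by
      rw [prod_div_distrib, mul_comm (∏ p ∈ T, (p : ℝ)), ← div_div]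
      ring
    rw [e] at h6
    linarith
  refine le_trans ?_ (sum_le_sum hterm)
  rw [sum_sub_distrib, ← mul_sum]
  exact sub_le_sub (mul_le_mul_of_nonneg_left h2
    (div_nonneg (Nat.cast_nonneg N) (prod_nonneg fun p _ => Nat.cast_nonneg p))) h3

/-! ### Linear forms with prescribed prime divisors -/

/-- The residue modulo `p` of the root of the linear form `a n + b`. -/
def linRoot (p : ℕ) (a b : ℤ) : ℕ := (-(b : ZMod p) * (a : ZMod p)⁻¹).val

lemma linRoot_lt {p : ℕ} (hp : p.Prime) (a b : ℤ) : linRoot p a b < p := by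
  have := Fact.mk hp
  exact ZMod.val_lt _

lemma dvd_linear_iff {p : ℕ} (hp : p.Prime) {a b : ℤ} (ha : ¬ (p : ℤ) ∣ a) (n : ℕ) :
    (p : ℤ) ∣ a * n + b ↔ n % p = linRoot p a b := by
  have := Fact.mk hp
  have ha' : (a : ZMod p) ≠ 0 := by rwa [Ne, ZMod.intCast_zmod_eq_zero_iff_dvd]
  rw [← ZMod.intCast_zmod_eq_zero_iff_dvd, linRoot, ← ZMod.val_natCast,
    (ZMod.val_injective p).eq_iff, eq_mul_inv_iff_mul_eq₀ ha']
  push_cast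
  rw [add_eq_zero_iff_eq_neg, mul_comm]

/-- A common root modulo `p` of both forms would force `p` to divide their determinant. -/
lemma linRoot_ne {p : ℕ} (hp : p.Prime) {a b a' b' : ℤ} (ha : ¬ (p : ℤ) ∣ a)
    (ha' : ¬ (p : ℤ) ∣ a') (h : ¬ (p : ℤ) ∣ a * b' - a' * b) : linRoot p a b ≠ linRoot p a' b' := by
  intro heq
  have hlt := linRoot_lt hp a b
  have h1 := (dvd_linear_iff hp ha (b := b) (linRoot p a b)).2 (Nat.mod_eq_of_lt hlt)
  have h2 := (dvd_linear_iff hp ha' (b := b') (linRoot p a b)).2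
    ((Nat.mod_eq_of_lt hlt).trans heq)
  apply h
  have e : a * b' - a' * b = a * (a' * (linRoot p a b : ℤ) + b') -
      a' * (a * (linRoot p a b : ℤ) + b) := by ring
  rw [e]
  exact dvd_sub (h2.mul_left _) (h1.mul_left _)

/-- The hypotheses on `S` for the linear forms `a i * n + b i`, read modulo a prime. -/
structure GoodPrimes {k : ℕ} (S : Finset ℕ) (a b : Fin k → ℤ) : Prop where
  two_mul_lt : ∀ p : ℕ, p.Prime → p ∉ S → 2 * k < p
  not_dvd : ∀ p : ℕ, p.Prime → p ∉ S → ∀ i, ¬ (p : ℤ) ∣ a i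
  not_dvd_det : ∀ p : ℕ, p.Prime → p ∉ S → ∀ i j, i ≠ j → ¬ (p : ℤ) ∣ a i * b j - a j * b i

/-- The `n ∈ [1, N]` such that `pp i` divides the `i`-th form, and no other prime of `P` divides
any of the forms. -/
def tupleSet {k : ℕ} (P : Finset ℕ) (a b : Fin k → ℤ) (N : ℕ) (pp : Fin k → ℕ) : Finset ℕ :=
  {n ∈ Ioc 0 N | (∀ i, (pp i : ℤ) ∣ linForm a b i n) ∧
    ∀ q ∈ P, q ∉ univ.image pp → ∀ i, ¬ (q : ℤ) ∣ linForm a b i n}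

theorem exists_card_tupleSet_lower_bound (k : ℕ) :
    ∃ B : ℕ, ∃ c : ℝ, 0 < c ∧ ∀ S : Finset ℕ, ∀ a b : Fin k → ℤ, GoodPrimes S a b →
      ∀ y : ℝ, 2 ≤ y → ∀ pp : Fin k → ℕ, Function.Injective pp →
        (∀ i, (pp i).Prime ∧ pp i ∉ S) → ∀ N : ℕ,
        N * (∏ i, 1 / (pp i : ℝ)) * (c / log y ^ k) - y ^ B ≤
          #(tupleSet (primesUnder y \ S) a b N pp) := by
  obtain ⟨B, hB⟩ := exists_card_residues_lower_bound k
  obtain ⟨c, hc, hV⟩ := exists_div_log_pow_le_prod k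
  refine ⟨B, c / 2, by positivity, fun S a b hg y hy pp hinj hpp N => ?_⟩
  set P := (primesUnder y \ S) \ univ.image pp with hPdef
  have hmem : ∀ p ∈ P, p.Prime ∧ p ∉ S ∧ (p : ℝ) < y ∧ p ∉ univ.image pp := fun p hp => by
    rw [hPdef, mem_sdiff, mem_sdiff, mem_primesUnder] at hp
    exact ⟨hp.1.1.2, hp.1.2, hp.1.1.1, hp.2⟩
  have hP : ∀ p ∈ P, p.Prime ∧ 2 * k < p ∧ (p : ℝ) < y := fun p hp => by
    obtain ⟨h1, h2, h3, -⟩ := hmem p hp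
    exact ⟨h1, hg.two_mul_lt p h1 h2, h3⟩
  -- For `q` outside the tuple, these are the roots of all `k` forms, to be avoided; for `q = pp i`,
  -- only the root of the `i`-th form remains, and it is prescribed.
  let R : ℕ → Finset ℕ := fun q =>
    ({i : Fin k | q ∉ univ.image pp ∨ pp i = q} : Finset (Fin k)).image
      fun i => linRoot q (a i) (b i)
  have hR : ∀ p, p.Prime → R p ⊆ range p := fun p hp r hr => by
    obtain ⟨i, -, rfl⟩ := mem_image.1 hr
    exact mem_range.2 (linRoot_lt hp _ _)
  have hinjR : ∀ q : ℕ, q.Prime → q ∉ S →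
      Function.Injective fun i => linRoot q (a i) (b i) := by
    intro q hq hqS i j hij
    by_contra hne
    exact linRoot_ne hq (hg.not_dvd q hq hqS i) (hg.not_dvd q hq hqS j)
      (hg.not_dvd_det q hq hqS i j hne) hij
  have hRP : ∀ p ∈ P, #(R p) = k := fun p hp => by
    obtain ⟨h1, h2, -, h4⟩ := hmem p hp
    rw [card_image_of_injective _ (hinjR p h1 h2), filter_true_of_mem fun i _ => Or.inl h4,
      card_univ, Fintype.card_fin]
  have hfil : ∀ i, ({j : Fin k | pp i ∉ univ.image pp ∨ pp j = pp i} : Finset (Fin k)) = {i} := by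
    intro i
    ext j
    simp [hinj.eq_iff]
  have hRT : ∀ p ∈ univ.image pp, #(R p) = 1 := fun p hp => by
    obtain ⟨i, -, rfl⟩ := mem_image.1 hp
    simp only [R, hfil, image_singleton, card_singleton]
  have hT : ∀ p ∈ univ.image pp, p.Prime := fun p hp => by
    obtain ⟨i, -, rfl⟩ := mem_image.1 hp
    exact (hpp i).1
  have key := hB y (by linarith) P hP (univ.image pp) hT disjoint_sdiff R hR hRP hRT N
  have hsub : {n ∈ Ioc 0 N | (∀ p ∈ univ.image pp, n % p ∈ R p) ∧ ∀ p ∈ P, n % p ∉ R p} ⊆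
      tupleSet (primesUnder y \ S) a b N pp := by
    intro n hn
    rw [mem_filter] at hn
    obtain ⟨hnN, h1, h2⟩ := hn
    refine mem_filter.2 ⟨hnN, fun i => ?_, fun q hq hqi i => ?_⟩
    · have := h1 (pp i) (mem_image_of_mem _ (mem_univ i))
      simp only [R, hfil, image_singleton, mem_singleton] at this
      exact (dvd_linear_iff (hpp i).1 (hg.not_dvd _ (hpp i).1 (hpp i).2 i) n).2 this
    · have hqP : q ∈ P := mem_sdiff.2 ⟨hq, hqi⟩
      obtain ⟨g1, g2, -, -⟩ := hmem q hqP
      intro hdvd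
      refine h2 q hqP (mem_image.2 ⟨i, mem_filter.2 ⟨mem_univ i, Or.inl hqi⟩, ?_⟩)
      exact ((dvd_linear_iff g1 (hg.not_dvd q g1 g2 i) n).1 hdvd).symm
  have hcard : (#{n ∈ Ioc 0 N | (∀ p ∈ univ.image pp, n % p ∈ R p) ∧ ∀ p ∈ P, n % p ∉ R p} : ℝ)
      ≤ #(tupleSet (primesUnder y \ S) a b N pp) := by exact_mod_cast card_le_card hsub
  refine le_trans ?_ (key.trans hcard)
  rw [prod_image fun i _ j _ h => hinj h]
  have e : (N : ℝ) * (∏ i, 1 / (pp i : ℝ)) = N / ∏ i, (pp i : ℝ) := by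
    rw [prod_div_distrib, prod_const_one, mul_one_div]
  rw [e]
  have := hV y hy P hP
  have h0 : (0 : ℝ) ≤ N / ∏ i, (pp i : ℝ) := by positivity
  have h1 : c / 2 / log y ^ k ≤ 1 / 2 * ∏ p ∈ P, (1 - (k : ℝ) / p) := by
    calc _ = 1 / 2 * (c / log y ^ k) := by ring
      _ ≤ _ := by linarith
  linarith [mul_le_mul_of_nonneg_left h1 h0]

/-- If `n` lies in both sets, then `pp i` divides a form at `n`, so it must be some `pp' j`;
disjointness of the blocks forces `j = i`. -/
lemma disjoint_tupleSet {k : ℕ} {P : Finset ℕ} {a b : Fin k → ℤ} {N : ℕ} {I : Fin k → Finset ℕ}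
    (hI : ∀ i, I i ⊆ P) (hdisj : ∀ i j, i ≠ j → Disjoint (I i) (I j)) {pp pp' : Fin k → ℕ}
    (hpp : ∀ i, pp i ∈ I i) (hpp' : ∀ i, pp' i ∈ I i) (hne : pp ≠ pp') :
    Disjoint (tupleSet P a b N pp) (tupleSet P a b N pp') := by
  rw [disjoint_left]
  intro n hn hn'
  apply hne
  funext i
  have h1 := (mem_filter.1 hn).2.1 i
  have h2 := (mem_filter.1 hn').2.2 (pp i) (hI i (hpp i))
  have h3 : pp i ∈ univ.image pp' := by
    by_contra h
    exact h2 h i h1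
  obtain ⟨j, -, hj⟩ := mem_image.1 h3
  by_cases hij : i = j
  · subst hij; exact hj.symm
  · exact absurd (hj ▸ hpp i) (disjoint_right.1 (hdisj i j hij) (hpp' j))

/-- The sum of `∏ 1 / pp i` over all tuples factors into the block sums, and there are at most `y ^
k` tuples to accumulate the error `E`. -/
lemma sum_card_tupleSet_lower_bound {k : ℕ} {S : Finset ℕ} {a b : Fin k → ℤ} {y δ V E : ℝ} {N : ℕ}
    {I : Fin k → Finset ℕ} (hδ : 0 ≤ δ) (hV : 0 ≤ V) (hE : 0 ≤ E)
    (hI : ∀ i, I i ⊆ primesUnder y \ S) (hdisj : ∀ i j, i ≠ j → Disjoint (I i) (I j))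
    (hsum : ∀ i, δ ≤ ∑ p ∈ I i, 1 / (p : ℝ)) (hy : 1 ≤ y)
    (hcard : ∀ pp : Fin k → ℕ, (∀ i, pp i ∈ I i) →
      N * (∏ i, 1 / (pp i : ℝ)) * V - E ≤ #(tupleSet (primesUnder y \ S) a b N pp)) :
    N * δ ^ k * V - y ^ k * E ≤
      #((Fintype.piFinset I).biUnion (tupleSet (primesUnder y \ S) a b N)) := by
  rw [card_biUnion fun pp hpp pp' hpp' hne => disjoint_tupleSet hI hdisj
    (Fintype.mem_piFinset.1 hpp) (Fintype.mem_piFinset.1 hpp') hne]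
  push_cast
  refine le_trans ?_ (sum_le_sum fun pp hpp => hcard pp (Fintype.mem_piFinset.1 hpp))
  rw [sum_sub_distrib, ← sum_mul, ← mul_sum, 
    ← prod_univ_sum (t := I) (f := fun _ p => 1 / (p : ℝ)), sum_const, nsmul_eq_mul]
  have h1 : δ ^ k ≤ ∏ i, ∑ p ∈ I i, 1 / (p : ℝ) := by
    calc δ ^ k = ∏ _i : Fin k, δ := by simp
      _ ≤ _ := prod_le_prod (fun _ _ => hδ) fun i _ => hsum i
  have h2 : (#(Fintype.piFinset I) : ℝ) ≤ y ^ k := by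
    rw [Fintype.card_piFinset]
    push_cast
    calc ∏ i, (#(I i) : ℝ) ≤ ∏ _i : Fin k, y := by
          refine prod_le_prod (fun _ _ => Nat.cast_nonneg _) fun i _ => ?_
          have hsub : I i ⊆ Ioc 0 ⌊y⌋₊ := fun q hq => by
            have := mem_primesUnder.1 (mem_sdiff.1 (hI i hq)).1
            exact mem_Ioc.2 ⟨this.2.pos, Nat.le_floor this.1.le⟩
          have := card_le_card hsub
          rw [Nat.card_Ioc, Nat.sub_zero] at this
          exact le_trans (by exact_mod_cast this) (Nat.floor_le (by linarith))
      _ = _ := by simp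
  have h3 : (N : ℝ) * δ ^ k ≤ N * ∏ i, ∑ p ∈ I i, 1 / (p : ℝ) :=
    mul_le_mul_of_nonneg_left h1 (Nat.cast_nonneg N)
  exact sub_le_sub (mul_le_mul_of_nonneg_right h3 hV) (mul_le_mul_of_nonneg_right h2 hE)

/-! ### Exceptional integers: small values and large square divisors -/

lemma card_filter_abs_linear_lt_le {a b : ℤ} (ha : a ≠ 0) {y : ℝ} (hy : 1 ≤ y) (N : ℕ) :
    (#((Ioc 0 N).filter fun n : ℕ => |((a * (n : ℤ) + b : ℤ) : ℝ)| < y) : ℝ) ≤ 3 * y := by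
  have hmaps : ∀ n ∈ ((Ioc 0 N).filter fun n : ℕ => |((a * (n : ℤ) + b : ℤ) : ℝ)| < y),
      a * (n : ℤ) + b ∈ Ioo (-(⌈y⌉ : ℤ)) ⌈y⌉ := by
    intro n hn
    have h := abs_lt.1 (mem_filter.1 hn).2
    have hc := Int.le_ceil y
    rw [mem_Ioo]
    constructor
    · have : (-(⌈y⌉ : ℤ) : ℝ) < ((a * (n : ℤ) + b : ℤ) : ℝ) := by linarith
      exact_mod_cast this
    · have : ((a * (n : ℤ) + b : ℤ) : ℝ) < (⌈y⌉ : ℝ) := by linarith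
      exact_mod_cast this
  have hinj : Set.InjOn (fun n : ℕ => a * (n : ℤ) + b)
      ((Ioc 0 N).filter fun n : ℕ => |((a * (n : ℤ) + b : ℤ) : ℝ)| < y) := by
    intro n _ m _ h
    have h' : a * (n : ℤ) = a * (m : ℤ) := by simpa using h
    exact_mod_cast mul_left_cancel₀ ha h'
  have h := card_le_card_of_injOn _ hmaps hinj
  rw [Int.card_Ioo] at h
  have hc := Int.ceil_lt_add_one y
  have hc0 : 0 < ⌈y⌉ := Int.ceil_pos.2 (by linarith)
  have h1 : ((⌈y⌉ - -⌈y⌉ - 1).toNat : ℤ) = 2 * ⌈y⌉ - 1 := by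
    rw [Int.toNat_of_nonneg (by omega)]; ring
  have h2 : (#((Ioc 0 N).filter fun n : ℕ => |((a * (n : ℤ) + b : ℤ) : ℝ)| < y) : ℤ) ≤ 2 * ⌈y⌉ - 1 := by
    rw [← h1]; exact_mod_cast h
  have h3 : (#((Ioc 0 N).filter fun n : ℕ => |((a * (n : ℤ) + b : ℤ) : ℝ)| < y) : ℝ) ≤ 2 * ⌈y⌉ - 1 := by
    exact_mod_cast h2
  linarith

lemma card_filter_sq_dvd_linear_le {a b : ℤ} {q : ℕ} (hq : q.Prime) (hqa : ¬ (q : ℤ) ∣ a) (N : ℕ) :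
    (#((Ioc 0 N).filter fun n : ℕ => ((q : ℤ) ^ 2) ∣ a * (n : ℤ) + b) : ℝ) ≤ N / (q : ℝ) ^ 2 + 1 := by
  rcases Finset.eq_empty_or_nonempty ((Ioc 0 N).filter fun n : ℕ => ((q : ℤ) ^ 2) ∣ a * (n : ℤ) + b) with h | h
  · rw [h, card_empty, Nat.cast_zero]; positivity
  · obtain ⟨m, hm⟩ := h
    have hm' := (mem_filter.1 hm).2
    have hsub : ((Ioc 0 N).filter fun n : ℕ => ((q : ℤ) ^ 2) ∣ a * (n : ℤ) + b) ⊆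
        ((Ioc 0 N).filter fun n : ℕ => n ≡ m [MOD q ^ 2]) := by
      intro n hn
      rw [mem_filter] at hn ⊢
      refine ⟨hn.1, ?_⟩
      have hd : ((q : ℤ) ^ 2) ∣ a * ((m : ℤ) - n) := by
        have e : a * ((m : ℤ) - n) = (a * (m : ℤ) + b) - (a * (n : ℤ) + b) := by ring
        rw [e]; exact dvd_sub hm' hn.2
      have hco : IsCoprime ((q : ℤ) ^ 2) a :=
        ((Nat.prime_iff_prime_int.1 hq).coprime_iff_not_dvd.2 hqa).pow_left
      rw [Nat.modEq_iff_dvd]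
      push_cast
      exact hco.dvd_of_dvd_mul_left hd
    have h1 := (abs_le.1 (abs_card_modEq_sub_le N (q ^ 2) m (pow_pos hq.pos 2))).2
    have h2 : (#((Ioc 0 N).filter fun n : ℕ => ((q : ℤ) ^ 2) ∣ a * (n : ℤ) + b) : ℝ) ≤
      #((Ioc 0 N).filter fun n : ℕ => n ≡ m [MOD q ^ 2]) := by exact_mod_cast card_le_card hsub
    push_cast at h1
    linarith

open Classical in
lemma card_filter_large_sq_dvd_linear_le {S : Finset ℕ} {a b : ℤ} {w X : ℝ} {N : ℕ}
    (hS : ∀ p : ℕ, p.Prime → p ∉ S → ¬ (p : ℤ) ∣ a) (hw : 0 < w) (hX : 0 ≤ X)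
    (hbound : ∀ n ∈ Ioc 0 N, |((a * (n : ℤ) + b : ℤ) : ℝ)| ≤ X ^ 2) :
    (#((Ioc 0 N).filter fun n : ℕ => a * (n : ℤ) + b ≠ 0 ∧ ∃ q : ℕ, q.Prime ∧ q ∉ S ∧ w ≤ q ∧
      ((q : ℤ) ^ 2) ∣ a * (n : ℤ) + b) : ℝ) ≤ 2 * N / w + X := by
  -- Since the value is nonzero and at most `X ^ 2` in size, `q ≤ X`. The open left endpoint `⌈w⌉₊ -
  -- 1` is what the tail bound for `∑ 1 / q ^ 2` needs to give `2 / w`.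
  set Q := {q ∈ Ioo (⌈w⌉₊ - 1) (⌊X⌋₊ + 1) | q.Prime ∧ q ∉ S} with hQ
  have hw1 : 1 ≤ ⌈w⌉₊ := Nat.ceil_pos.2 hw
  have hsub : ((Ioc 0 N).filter fun n : ℕ => a * (n : ℤ) + b ≠ 0 ∧ ∃ q : ℕ, q.Prime ∧ q ∉ S ∧ w ≤ q ∧
      ((q : ℤ) ^ 2) ∣ a * (n : ℤ) + b) ⊆
      Q.biUnion fun q => ((Ioc 0 N).filter fun n : ℕ => ((q : ℤ) ^ 2) ∣ a * (n : ℤ) + b) := by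
    intro n hn
    rw [mem_filter] at hn
    obtain ⟨hnN, h0, q, h1, h2, h3, h4⟩ := hn
    rw [mem_biUnion]
    refine ⟨q, mem_filter.2 ⟨mem_Ioo.2 ⟨?_, ?_⟩, h1, h2⟩, mem_filter.2 ⟨hnN, h4⟩⟩
    · have := Nat.ceil_le.2 h3
      omega
    · refine Nat.lt_succ_of_le (Nat.le_floor ?_)
      have h5 := Int.le_of_dvd (abs_pos.2 h0) ((dvd_abs _ _).2 h4)
      have h6 : ((q : ℝ)) ^ 2 ≤ |((a * (n : ℤ) + b : ℤ) : ℝ)| := by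
        rw [← Int.cast_abs]; exact_mod_cast h5
      exact le_of_sq_le_sq (h6.trans (hbound n hnN)) hX
  have h1 : (#((Ioc 0 N).filter fun n : ℕ => a * (n : ℤ) + b ≠ 0 ∧ ∃ q : ℕ, q.Prime ∧ q ∉ S ∧ w ≤ q ∧
      ((q : ℤ) ^ 2) ∣ a * (n : ℤ) + b) : ℝ) ≤
      ∑ q ∈ Q, (#((Ioc 0 N).filter fun n : ℕ => ((q : ℤ) ^ 2) ∣ a * (n : ℤ) + b) : ℝ) := by
    exact_mod_cast (card_le_card hsub).trans card_biUnion_le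
  refine h1.trans ((sum_le_sum fun q hq => ?_).trans (b := ∑ q ∈ Q, (N * ((q : ℝ) ^ 2)⁻¹ + 1)) ?_)
  · have := (mem_filter.1 hq).2
    rw [← div_eq_mul_inv]
    exact card_filter_sq_dvd_linear_le this.1 (hS q this.1 this.2) N
  · rw [sum_add_distrib, ← mul_sum, sum_const, nsmul_eq_mul, mul_one]
    have h2 : ∑ q ∈ Q, ((q : ℝ) ^ 2)⁻¹ ≤ 2 / w := by
      refine (sum_le_sum_of_subset_of_nonneg (filter_subset _ _) fun _ _ _ => by positivity).trans
        ((sum_Ioo_inv_sq_le (α := ℝ) _ _).trans ?_)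
      have : w ≤ ((⌈w⌉₊ - 1 : ℕ) : ℝ) + 1 := by
        rw [Nat.cast_sub hw1]; simpa using Nat.le_ceil w
      gcongr
    have h3 : (#Q : ℝ) ≤ X := by
      have : #Q ≤ ⌊X⌋₊ := by
        refine (card_le_card (filter_subset _ _)).trans ?_
        rw [Nat.card_Ioo]; omega
      exact le_trans (by exact_mod_cast this) (Nat.floor_le hX)
    have h4 := mul_le_mul_of_nonneg_left h2 (Nat.cast_nonneg (α := ℝ) N)
    have e : (N : ℝ) * (2 / w) = 2 * N / w := by ring
    linarith

/-- Induction on the absolute value: a prime whose square divides `m` lies in `S`, and one factor of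
it can be moved into the `S`-unit. -/
lemma isSigmaSquarefree_of_sq_not_dvd {S : Finset ℕ} (m : ℤ) (hm : m ≠ 0)
    (h : ∀ q : ℕ, q.Prime → q ∉ S → ¬ ((q : ℤ) ^ 2) ∣ m) : IsSigmaSquarefree S m := by
  induction hn : m.natAbs using Nat.strong_induction_on generalizing m with
  | _ n ih =>
    by_cases hsq : ∃ q : ℕ, q.Prime ∧ ((q : ℤ) ^ 2) ∣ m
    · obtain ⟨q, hq, m', rfl⟩ := hsq
      have hqS : q ∈ S := by
        by_contra hqS
        exact h q hq hqS (dvd_mul_right _ _)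
      have hm' : (q : ℤ) * m' ≠ 0 := by
        rintro h0
        exact hm (by rw [pow_two, mul_assoc, h0, mul_zero])
      have hlt : ((q : ℤ) * m').natAbs < n := by
        have hpos := Int.natAbs_pos.2 hm'
        rw [← hn, pow_two, mul_assoc, Int.natAbs_mul (q : ℤ) ((q : ℤ) * m'), Int.natAbs_natCast]
        exact lt_mul_of_one_lt_left hpos hq.one_lt
      obtain ⟨u, s, hu, hs, e⟩ := ih _ hlt ((q : ℤ) * m') hm' (fun q' hq' hq'S hd =>
        h q' hq' hq'S (hd.trans ⟨q, by ring⟩)) rfl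
      refine ⟨q * u, s, fun p hp hd => ?_, hs, by rw [pow_two, mul_assoc, e, mul_assoc]⟩
      rcases (Nat.prime_iff_prime_int.1 hp).dvd_or_dvd hd with hd | hd
      · have := (Nat.prime_dvd_prime_iff_eq hp hq).1 (by exact_mod_cast hd)
        exact this ▸ hqS
      · exact hu p hp hd
    · refine ⟨1, m, fun p hp hd => ?_, ?_, by rw [one_mul]⟩
      · exact absurd ((Nat.prime_iff_prime_int.1 hp).not_isUnit (isUnit_of_dvd_one hd)) (by simp)
      · rw [← Int.squarefree_natAbs, Nat.squarefree_iff_prime_squarefree]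
        intro p hp hd
        refine hsq ⟨p, hp, ?_⟩
        rw [← Int.dvd_natAbs, pow_two]
        exact_mod_cast hd

lemma sievedSet₁_finite {k : ℕ} (S : Finset ℕ) (a b : Fin k → ℤ) (x z : ℝ) :
    (sievedSet₁ S a b x z).Finite :=
  (Set.finite_Iic ⌊x⌋₊).subset fun _ hn => Nat.le_floor hn.1.2.1

/-- Outside the two exceptional sets, every integer found by the sieve is good. Prime factors
outside `S` are at least `w`, being either members of the tuple or at least `y`; and `pp i < y` is a
proper divisor of the `i`-th value. -/
lemma card_biUnion_tupleSet_le {k : ℕ} {S : Finset ℕ} {a b : Fin k → ℤ} (hg : GoodPrimes S a b)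
    (ha : ∀ i, a i ≠ 0) {x y z w X : ℝ} (hx : 0 ≤ x) (hw : 0 < w) (hzw : z ≤ w) (hwy : w ≤ y)
    (hy : 1 ≤ y) (hX : 0 ≤ X) {I : Fin k → Finset ℕ} (hI : ∀ i, I i ⊆ primesUnder y \ S)
    (hIw : ∀ i, ∀ p ∈ I i, w ≤ p)
    (hbound : ∀ i, ∀ n ∈ Ioc 0 ⌊x⌋₊, |((linForm a b i n : ℤ) : ℝ)| ≤ X ^ 2) :
    (#((Fintype.piFinset I).biUnion (tupleSet (primesUnder y \ S) a b ⌊x⌋₊)) : ℝ) ≤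
      (sievedSet₁ S a b x z).ncard + k * (3 * y + (2 * x / w + X)) := by
  classical
  set N := ⌊x⌋₊ with hN
  have hNx : (N : ℝ) ≤ x := Nat.floor_le hx
  set G := (Fintype.piFinset I).biUnion (tupleSet (primesUnder y \ S) a b N) with hG
  let bad₁ : Fin k → Finset ℕ := fun i =>
    (Ioc 0 N).filter fun n : ℕ => |((a i * (n : ℤ) + b i : ℤ) : ℝ)| < y
  let bad₂ : Fin k → Finset ℕ := fun i =>
    (Ioc 0 N).filter fun n : ℕ => a i * (n : ℤ) + b i ≠ 0 ∧ ∃ q : ℕ, q.Prime ∧ q ∉ S ∧ w ≤ q ∧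
      ((q : ℤ) ^ 2) ∣ a i * (n : ℤ) + b i
  have hsub : G ⊆ (sievedSet₁_finite S a b x z).toFinset ∪
      univ.biUnion fun i => bad₁ i ∪ bad₂ i := by
    intro n hn
    obtain ⟨pp, hpp, hn⟩ := mem_biUnion.1 hn
    rw [Fintype.mem_piFinset] at hpp
    obtain ⟨hnN, hdvd, hother⟩ := mem_filter.1 hn
    have hppP : ∀ i, (pp i : ℝ) < y ∧ (pp i).Prime := fun i =>
      mem_primesUnder.1 (mem_sdiff.1 (hI i (hpp i))).1
    rw [mem_union, or_iff_not_imp_right]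
    intro hbad
    have hbad' : ∀ i, n ∉ bad₁ i ∧ n ∉ bad₂ i := fun i => by
      rw [← not_or, ← mem_union]
      exact fun h => hbad (mem_biUnion.2 ⟨i, mem_univ i, h⟩)
    have hlarge : ∀ i, y ≤ |((linForm a b i n : ℤ) : ℝ)| := fun i => by
      by_contra h
      exact (hbad' i).1 (mem_filter.2 ⟨hnN, not_le.1 h⟩)
    have hne : ∀ i, linForm a b i n ≠ 0 := fun i h0 => by
      have := hlarge i
      rw [h0] at this
      simp at this
      linarith
    have hbig : ∀ q : ℕ, q.Prime → q ∉ S → ∀ i, (q : ℤ) ∣ linForm a b i n → w ≤ q := by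
      intro q hq hqS i hd
      rcases lt_or_ge (q : ℝ) y with h | h
      · by_cases hqi : q ∈ univ.image pp
        · obtain ⟨j, -, rfl⟩ := mem_image.1 hqi
          exact hIw j _ (hpp j)
        · exact absurd hd
            (hother q (mem_sdiff.2 ⟨mem_primesUnder.2 ⟨h, hq⟩, hqS⟩) hqi i)
      · exact hwy.trans h
    rw [Set.Finite.mem_toFinset]
    have hn1 := mem_Ioc.1 hnN
    refine ⟨⟨hn1.1, (Nat.cast_le.2 hn1.2).trans hNx, ?_⟩, fun i => ⟨?_, ?_, ?_⟩⟩
    · by_contra hgcd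
      obtain ⟨q, hq, hqd⟩ := Nat.exists_prime_and_dvd hgcd
      have h1 : (q : ℤ) ∣ ∏ i, linForm a b i n :=
        (Int.natCast_dvd_natCast.2 hqd).trans (Int.gcd_dvd_left _ _)
      have h2 : (q : ℤ) ∣ (primeProd S z : ℤ) :=
        (Int.natCast_dvd_natCast.2 hqd).trans (Int.gcd_dvd_right _ _)
      rw [Int.natCast_dvd_natCast, primeProd, hq.prime.dvd_finsetProd_iff] at h2
      obtain ⟨r, hr, hqr⟩ := h2
      rw [mem_filter, mem_range, Nat.lt_ceil] at hr
      have hqr' : q = r := (Nat.prime_dvd_prime_iff_eq hq hr.2.1).1 hqr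
      subst hqr'
      obtain ⟨i, -, hi⟩ := ((Nat.prime_iff_prime_int.1 hq).dvd_finsetProd_iff _).1 h1
      have := hbig q hq hr.2.2 i hi
      linarith [hr.1]
    · refine isSigmaSquarefree_of_sq_not_dvd _ (hne i) fun q hq hqS hd => ?_
      have := hbig q hq hqS i ((dvd_pow_self _ two_ne_zero).trans hd)
      exact (hbad' i).2 (mem_filter.2 ⟨hnN, hne i, q, hq, hqS, this, hd⟩)
    · have h1 : pp i ∣ (linForm a b i n).natAbs := Int.natCast_dvd.1 (hdvd i)
      exact (hppP i).2.one_lt.trans_le (Nat.le_of_dvd (Int.natAbs_pos.2 (hne i)) h1)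
    · intro hprime
      have h1 : pp i ∣ (linForm a b i n).natAbs := Int.natCast_dvd.1 (hdvd i)
      have h2 := (Nat.prime_dvd_prime_iff_eq (hppP i).2 hprime).1 h1
      have h3 := hlarge i
      rw [← Int.cast_abs, Int.abs_eq_natAbs, ← h2] at h3
      have := (hppP i).1
      push_cast at h3
      linarith
  have hbad₂ : ∀ i, (#(bad₂ i) : ℝ) ≤ 2 * N / w + X := fun i => by
    convert card_filter_large_sq_dvd_linear_le (b := b i)
      (fun p hp hpS => hg.not_dvd p hp hpS i) hw hX (hbound i)
  have hcard := (card_le_card hsub).trans (card_union_le _ _)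
  rw [← Set.ncard_eq_toFinset_card _ (sievedSet₁_finite S a b x z)] at hcard
  have hbadcard : (#(univ.biUnion fun i => bad₁ i ∪ bad₂ i) : ℝ) ≤
      k * (3 * y + (2 * x / w + X)) := by
    have h1 : (#(univ.biUnion fun i => bad₁ i ∪ bad₂ i) : ℝ) ≤
        ∑ i, ((#(bad₁ i) : ℝ) + #(bad₂ i)) := by
      exact_mod_cast card_biUnion_le.trans (sum_le_sum fun i _ => card_union_le _ _)
    refine h1.trans ((sum_le_sum fun i _ => add_le_add
      (card_filter_abs_linear_lt_le (b := b i) (ha i) hy N)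
      ((hbad₂ i).trans (c := 2 * x / w + X) ?_)).trans ?_)
    · gcongr
    · rw [sum_const, card_univ, Fintype.card_fin, nsmul_eq_mul]
  have : (#G : ℝ) ≤ (sievedSet₁ S a b x z).ncard +
      #(univ.biUnion fun i => bad₁ i ∪ bad₂ i) := by exact_mod_cast hcard
  linarith

/-! ### Prime blocks and the choice of parameters -/

/-- The primes of `[z ^ A ^ (i + 1), z ^ A ^ (i + 2))` outside `S`. -/
noncomputable def primeBlock (S : Finset ℕ) (z : ℝ) (A i : ℕ) : Finset ℕ :=
  (primesUnder (z ^ A ^ (i + 2)) \ primesUnder (z ^ A ^ (i + 1))) \ S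

lemma mem_primeBlock {S : Finset ℕ} {z : ℝ} {A i p : ℕ} :
    p ∈ primeBlock S z A i ↔
      p.Prime ∧ p ∉ S ∧ z ^ A ^ (i + 1) ≤ (p : ℝ) ∧ (p : ℝ) < z ^ A ^ (i + 2) := by
  rw [primeBlock, mem_sdiff, mem_sdiff, mem_primesUnder, mem_primesUnder, not_and', ← not_lt]
  tauto

lemma pow_pow_le_pow_pow {z : ℝ} (hz : 1 ≤ z) {A i j : ℕ} (hA : 1 ≤ A) (hij : i ≤ j) :
    z ^ A ^ i ≤ z ^ A ^ j :=
  pow_le_pow_right₀ hz (Nat.pow_le_pow_right hA hij)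

lemma disjoint_primeBlock (S : Finset ℕ) {z : ℝ} (hz : 1 ≤ z) {A i j : ℕ} (hA : 1 ≤ A)
    (hij : i ≠ j) : Disjoint (primeBlock S z A i) (primeBlock S z A j) := by
  rw [disjoint_left]
  intro p hp hp'
  rw [mem_primeBlock] at hp hp'
  rcases lt_or_gt_of_ne hij with h | h
  · have := pow_pow_le_pow_pow hz hA (show i + 2 ≤ j + 1 by omega)
    linarith [hp.2.2.2, hp'.2.2.1]
  · have := pow_pow_le_pow_pow hz hA (show j + 2 ≤ i + 1 by omega)
    linarith [hp'.2.2.2, hp.2.2.1]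

/-- The lower bound for the number of `n` with `S`-square-free composite values, before the
parameters `A` and `X` are chosen. -/
theorem exists_ncard_sievedSet₁_lower_bound (k : ℕ) (hk : 1 ≤ k) :
    ∃ B : ℕ, ∃ c : ℝ, 0 < c ∧ ∀ S : Finset ℕ, ∀ a b : Fin k → ℤ, GoodPrimes S a b →
      (∀ i, a i ≠ 0) → ∀ A : ℕ, 4 * (#S + 10) ≤ A → ∀ x z X : ℝ, 1 ≤ x → 2 ≤ z → 0 ≤ X →
      (∀ i, ((|a i| + |b i| : ℤ) : ℝ) ≤ z) → z * x ≤ X ^ 2 →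
        x / 2 * (1 / 4) ^ k * (c / (A ^ (k + 1) * log z) ^ k) -
          (z ^ A ^ (k + 1)) ^ (B + k) - k * (3 * z ^ A ^ (k + 1) + (2 * x / z ^ A + X)) ≤
          (sievedSet₁ S a b x z).ncard := by
  obtain ⟨B, c, hc, H⟩ := exists_card_tupleSet_lower_bound k
  refine ⟨B, c, hc, fun S a b hg ha A hA x z X hx hz hX hab hzx => ?_⟩
  have hA1 : 1 ≤ A := by omega
  have hz1 : 1 ≤ z := by linarith
  set y := z ^ A ^ (k + 1) with hy
  have hwy : z ^ A ≤ y := by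
    have := pow_pow_le_pow_pow hz1 hA1 (show 1 ≤ k + 1 by omega)
    rwa [pow_one] at this
  have hzw : z ≤ z ^ A := le_self_pow₀ hz1 (by omega)
  have hy2 : 2 ≤ y := by linarith
  have hl : 0 < log z := log_pos (by linarith)
  have hlogy : log y = A ^ (k + 1) * log z := by
    rw [hy, log_pow]; push_cast; rfl
  have hI : ∀ i : Fin k, primeBlock S z A i ⊆ primesUnder y \ S := fun i p hp => by
    rw [mem_primeBlock] at hp
    refine mem_sdiff.2 ⟨mem_primesUnder.2 ⟨hp.2.2.2.trans_le ?_, hp.1⟩, hp.2.1⟩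
    exact pow_pow_le_pow_pow hz1 hA1 (by have := i.2; omega)
  have hdisj : ∀ i j : Fin k, i ≠ j → Disjoint (primeBlock S z A i) (primeBlock S z A j) :=
    fun i j hij => disjoint_primeBlock S hz1 hA1 (fun h => hij (Fin.ext h))
  have hsum : ∀ i : Fin k, (1 / 4 : ℝ) ≤ ∑ p ∈ primeBlock S z A i, 1 / (p : ℝ) := fun i => by
    have hw : (2 : ℝ) ≤ z ^ A ^ ((i : ℕ) + 1) :=
      hz.trans (le_self_pow₀ hz1 (pow_pos (by omega) _).ne')
    have := quarter_le_sum_inv_primesUnder_sdiff hw S hA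
    rwa [← pow_mul, ← pow_succ] at this
  have hV : 0 ≤ c / log y ^ k := by
    rw [hlogy]; positivity
  have h1 := sum_card_tupleSet_lower_bound (a := a) (b := b) (N := ⌊x⌋₊) (E := y ^ B)
    (by norm_num : (0 : ℝ) ≤ 1 / 4) hV (by positivity) hI hdisj hsum (by linarith)
    fun pp hpp => by
      have hpp' : ∀ i, (pp i).Prime ∧ pp i ∉ S := fun i =>
        ⟨(mem_primeBlock.1 (hpp i)).1, (mem_primeBlock.1 (hpp i)).2.1⟩
      refine H S a b hg y hy2 pp (fun i j hij => ?_) hpp' _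
      by_contra hne
      exact disjoint_left.1 (hdisj i j hne) (hpp i) (hij ▸ hpp j)
  have h2 := card_biUnion_tupleSet_le hg ha (x := x) (z := z) (X := X) (by linarith)
    (by positivity : 0 < z ^ A) hzw hwy (by linarith) hX hI
    (fun i p hp => by
      refine le_trans ?_ (mem_primeBlock.1 hp).2.2.1
      have := pow_pow_le_pow_pow hz1 hA1 (show 1 ≤ (i : ℕ) + 1 by omega)
      rwa [pow_one] at this)
    (fun i n hn => by
      refine le_trans ?_ hzx
      have hn' := mem_Ioc.1 hn
      have hnx : (n : ℝ) ≤ x := (Nat.cast_le.2 hn'.2).trans (Nat.floor_le (by linarith))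
      have hab' := hab i
      push_cast at hab'
      rw [linForm]
      push_cast
      calc |(a i : ℝ) * n + b i| ≤ |(a i : ℝ)| * n + |(b i : ℝ)| := by
            refine (abs_add_le _ _).trans_eq ?_
            rw [abs_mul, Nat.abs_cast]
        _ ≤ |(a i : ℝ)| * x + |(b i : ℝ)| * x := by
            have := mul_le_mul_of_nonneg_left hnx (abs_nonneg (a i : ℝ))
            have := le_mul_of_one_le_right (abs_nonneg (b i : ℝ)) hx
            linarith
        _ = (|(a i : ℝ)| + |(b i : ℝ)|) * x := by ring
        _ ≤ z * x := mul_le_mul_of_nonneg_right hab' (by linarith))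
  have hfl : x / 2 ≤ ⌊x⌋₊ := by
    have h3 := Nat.lt_floor_add_one x
    have h4 : (1 : ℝ) ≤ ⌊x⌋₊ := by exact_mod_cast Nat.floor_pos.2 hx
    linarith
  have h5 : x / 2 * (1 / 4) ^ k * (c / log y ^ k) ≤ ⌊x⌋₊ * (1 / 4) ^ k * (c / log y ^ k) := by
    gcongr
  rw [hlogy] at h5 h1
  rw [pow_add y, mul_comm (y ^ B)]
  linarith

lemma exists_pow_mul_le_two_pow (K : ℕ) (C : ℝ) (hC : 0 < C) (m : ℕ) :
    ∃ A : ℕ, m ≤ A ∧ C * (A : ℝ) ^ K ≤ 2 ^ A := by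
  have h := tendsto_pow_const_div_const_pow_of_one_lt K (by norm_num : (1 : ℝ) < 2)
  obtain ⟨A, hA, hm⟩ := ((h.eventually_lt_const (by positivity : 0 < 1 / C)).and
    (Filter.eventually_ge_atTop m)).exists
  refine ⟨A, hm, ?_⟩
  rw [div_lt_div_iff₀ (by positivity) hC] at hA
  linarith

lemma log_pow_le_factorial_mul {z : ℝ} (hz : 1 ≤ z) (k : ℕ) : log z ^ k ≤ k.factorial * z := by
  have := pow_div_factorial_le_exp (log z) (log_nonneg hz) k
  rw [exp_log (by linarith), div_le_iff₀ (by positivity)] at this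
  linarith

/-- The order of choices matters: `A` is fixed from `k` and `s` so that the square-divisor loss is
at most a quarter of the main term for all `z ≥ 2`; only then is `η` taken so small that every power
of `y` is negligible against `x`. -/
theorem exists_exponent_and_constant (k s : ℕ) (hk : 1 ≤ k) :
    ∃ η c₁ : ℝ, η ∈ Set.Ioc (0 : ℝ) (1 / 2) ∧ c₁ ∈ Set.Ioc (0 : ℝ) (1 / 2) ∧
      ∀ S : Finset ℕ, #S = s → ∀ a b : Fin k → ℤ, GoodPrimes S a b → (∀ i, a i ≠ 0) →
        ∀ x z : ℝ, 2 ≤ x → 2 ≤ z → (∀ i, ((|a i| + |b i| : ℤ) : ℝ) ≤ z) → z ≤ x ^ η →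
          c₁ * (x / log z ^ k) ≤ (sievedSet₁ S a b x z).ncard := by
  obtain ⟨B, c, hc, H⟩ := exists_ncard_sievedSet₁_lower_bound k hk
  have hf : (0 : ℝ) < k.factorial := by exact_mod_cast k.factorial_pos
  have hk0 : (0 : ℝ) < k := by exact_mod_cast hk
  obtain ⟨A, hAs, hA⟩ := exists_pow_mul_le_two_pow ((k + 1) * k)
    (32 * k * k.factorial * 4 ^ k / c) (by positivity) (4 * (s + 10))
  have hA0 : (0 : ℝ) < A := by exact_mod_cast (by omega : 0 < A)
  set c' : ℝ := 1 / 2 * (1 / 4) ^ k * c / (A ^ (k + 1)) ^ k with hc'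
  have hc'0 : 0 < c' := by positivity
  -- The first summand makes `z ^ m` dominate `y ^ (B + k)` and `y`. The second makes `r = x ^ (1 /
  -- 8)` exceed a needed constant, because `r ≥ z ^ m ≥ 2 ^ m ≥ m`; so no lower bound on `z` beyond
  -- `2` and the coefficient sizes is required.
  set m : ℕ := A ^ (k + 1) * (B + k + 1) + ⌈4 * (1 + 4 * k) * k.factorial / c'⌉₊ with hm
  have hm1 : 1 ≤ m := by
    have : 0 < A ^ (k + 1) * (B + k + 1) := Nat.mul_pos (pow_pos (by omega) _) (by omega)
    omega
  have hm1' : (1 : ℝ) ≤ m := by exact_mod_cast hm1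
  refine ⟨1 / (8 * m), min (c' / 2) (1 / 2), ⟨by positivity, ?_⟩,
    ⟨by positivity, min_le_right _ _⟩, ?_⟩
  · apply one_div_le_one_div_of_le <;> linarith
  intro S hS a b hg ha x z hx hz hab hzx
  have hz1 : 1 ≤ z := by linarith
  have hx0 : 0 < x := by linarith
  set r : ℝ := x ^ (1 / 8 : ℝ) with hr
  have hr8 : r ^ 8 = x := by
    rw [hr, ← rpow_mul_natCast hx0.le]; norm_num
  have hzm : z ^ m ≤ r := by
    calc z ^ m ≤ (x ^ (1 / (8 * m) : ℝ)) ^ m := by gcongr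
      _ = r := by
        rw [hr, ← rpow_mul_natCast hx0.le]
        congr 1
        field_simp
  have hzr : z ≤ r := (le_self_pow₀ hz1 (by omega)).trans hzm
  have hr1 : 1 ≤ r := hz1.trans hzr
  have hr0 : 0 < r := by linarith
  have hl : 0 < log z := log_pos (by linarith)
  have hL : log z ^ k ≤ k.factorial * z := log_pow_le_factorial_mul hz1 k
  have hmr : (m : ℝ) ≤ r := by
    have h1 : (m : ℝ) ≤ 2 ^ m := by exact_mod_cast Nat.lt_two_pow_self.le
    have h2 : (2 : ℝ) ^ m ≤ z ^ m := by gcongr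
    linarith
  have hconst : 4 * (1 + 4 * k) * k.factorial / c' ≤ r := by
    refine (Nat.le_ceil _).trans (le_trans ?_ hmr)
    exact Nat.cast_le.2 (Nat.le_add_left _ _)
  have hX : z * x ≤ (r ^ 5) ^ 2 := by
    rw [← hr8]
    calc z * r ^ 8 ≤ r * r ^ 8 := by gcongr
      _ = r ^ 9 * 1 := by ring
      _ ≤ r ^ 9 * r := by gcongr
      _ = _ := by ring
  have key := H S a b hg ha A (by rw [hS]; exact hAs) x z (r ^ 5) (by linarith) hz (by positivity)
    hab hX
  have hmain : x / 2 * (1 / 4) ^ k * (c / (A ^ (k + 1) * log z) ^ k) = c' * (x / log z ^ k) := by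
    rw [hc', mul_pow]
    field_simp
  have hbase : ∀ e : ℕ, e ≤ m → z ^ e ≤ r ^ 5 := fun e he =>
    (pow_le_pow_right₀ hz1 he).trans (hzm.trans (le_self_pow₀ hr1 (by norm_num)))
  have he1 : (z ^ A ^ (k + 1)) ^ (B + k) ≤ r ^ 5 := by
    rw [← pow_mul]
    exact hbase _ ((Nat.mul_le_mul_left _ (by omega)).trans (Nat.le_add_right _ _))
  have he2 : z ^ A ^ (k + 1) ≤ r ^ 5 :=
    hbase _ ((Nat.le_mul_of_pos_right _ (by omega)).trans (Nat.le_add_right _ _))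
  -- The coefficient collects `y ^ (B + k)`, `3 * k * y` and `k * X`, each power of `y` and `X`
  -- being at most `r ^ 5`, whereas `x = r ^ 8`.
  have he3 : (1 + 4 * k) * r ^ 5 ≤ c' / 4 * (x / log z ^ k) := by
    rw [← mul_div_assoc, le_div_iff₀ (by positivity), ← hr8]
    have h1 : log z ^ k ≤ k.factorial * r := hL.trans (by gcongr)
    rw [div_le_iff₀ hc'0] at hconst
    calc (1 + 4 * k) * r ^ 5 * log z ^ k ≤ (1 + 4 * k) * r ^ 5 * (k.factorial * r) := by gcongr
      _ = (4 * (1 + 4 * k) * k.factorial) / 4 * r ^ 6 := by ring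
      _ ≤ (r * c') / 4 * r ^ 6 := by gcongr
      _ = c' / 4 * r ^ 7 * 1 := by ring
      _ ≤ c' / 4 * r ^ 7 * r := by gcongr
      _ = _ := by ring
  have he4 : k * (2 * x / z ^ A) ≤ c' / 4 * (x / log z ^ k) := by
    have h1 : 8 * k * k.factorial * z ≤ c' * z ^ A := by
      have h2 : 16 * k * k.factorial ≤ c' * 2 ^ A := by
        rw [div_mul_eq_mul_div, div_le_iff₀ hc, pow_mul] at hA
        rw [hc', div_mul_eq_mul_div, le_div_iff₀ (by positivity), one_div_pow]
        have e : 1 / 2 * (1 / 4 ^ k) * c * 2 ^ A = (2 ^ A * c) / (2 * 4 ^ k) := by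
          field_simp
        rw [e, le_div_iff₀ (by positivity)]
        linarith
      -- One factor `z` of `z ^ A` is kept to absorb `(log z) ^ k ≤ k! * z`; the others are bounded
      -- below by `2`.
      have hA1 : (2 : ℝ) ^ A * z ≤ 2 * z ^ A := by
        obtain ⟨A', rfl⟩ : ∃ A', A = A' + 1 := ⟨A - 1, by omega⟩
        rw [pow_succ, pow_succ]
        have : (2 : ℝ) ^ A' ≤ z ^ A' := by gcongr
        nlinarith
      have h3 : (16 * k * k.factorial) * z ≤ (c' * 2 ^ A) * z := by gcongr
      have h4 : c' * (2 ^ A * z) ≤ c' * (2 * z ^ A) := by gcongr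
      linarith
    have h5 : 8 * k * log z ^ k ≤ c' * z ^ A := by
      refine le_trans ?_ h1
      calc 8 * k * log z ^ k ≤ 8 * k * (k.factorial * z) := by gcongr
        _ = _ := by ring
    rw [← mul_div_assoc, ← mul_div_assoc, div_le_div_iff₀ (by positivity) (by positivity)]
    nlinarith
  have hfin : min (c' / 2) (1 / 2) * (x / log z ^ k) ≤ c' / 2 * (x / log z ^ k) := by
    gcongr
    exact min_le_left _ _
  rw [hmain] at key
  have he5 : k * z ^ A ^ (k + 1) ≤ k * r ^ 5 := by gcongr
  linarith

/-- The numbers `η k s` and `c₁ k s` depend only on the number `k` of forms and on the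
cardinality `s` of `S`; `z₁` depends only on the coefficients of the forms. -/
theorem theorem3p1 :
    ∃ η c₁ : ℕ → ℕ → ℝ,
      (∀ k s : ℕ, η k s ∈ Set.Ioc (0 : ℝ) (1 / 2) ∧ c₁ k s ∈ Set.Ioc (0 : ℝ) (1 / 2)) ∧
      ∀ (k : ℕ), 1 ≤ k → ∀ (a b : Fin k → ℤ),
        (∀ i : Fin k, a i ≠ 0 ∧ Int.gcd (a i) (b i) = 1) →
        (∀ i j : Fin k, i ≠ j → a i * b j - a j * b i ≠ 0) →
        ∃ z₁ : ℝ, 2 ≤ z₁ ∧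
          ∀ S : Finset ℕ,
            (∀ p ∈ S, p.Prime) →
            (∀ p : ℕ, p.Prime → p ≤ 2 * k → p ∈ S) →
            (∀ i : Fin k, IsSigmaUnit S (a i)) →
            (∀ i j : Fin k, i ≠ j → IsSigmaUnit S (a i * b j - a j * b i)) →
            ∀ x z : ℝ, 2 ≤ x → z₁ ≤ z → z ≤ x ^ η k S.card →
              c₁ k S.card * (x / Real.log z ^ k) ≤ ((sievedSet₁ S a b x z).ncard : ℝ) := by
  have H : ∀ k s : ℕ, ∃ e : ℝ × ℝ, e.1 ∈ Set.Ioc (0 : ℝ) (1 / 2) ∧ e.2 ∈ Set.Ioc (0 : ℝ) (1 / 2) ∧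
      (1 ≤ k → ∀ S : Finset ℕ, #S = s → ∀ a b : Fin k → ℤ, GoodPrimes S a b → (∀ i, a i ≠ 0) →
        ∀ x z : ℝ, 2 ≤ x → 2 ≤ z → (∀ i, ((|a i| + |b i| : ℤ) : ℝ) ≤ z) → z ≤ x ^ e.1 →
          e.2 * (x / log z ^ k) ≤ (sievedSet₁ S a b x z).ncard) := by
    intro k s
    by_cases hk : 1 ≤ k
    · obtain ⟨η, c₁, h1, h2, h3⟩ := exists_exponent_and_constant k s hk
      exact ⟨(η, c₁), h1, h2, fun _ => h3⟩
    · exact ⟨(1 / 2, 1 / 2), by norm_num, by norm_num, fun h => absurd h hk⟩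
  choose e he1 he2 he3 using H
  refine ⟨fun k s => (e k s).1, fun k s => (e k s).2, fun k s => ⟨he1 k s, he2 k s⟩,
    -- With this `z₁`, each `|a i| + |b i|` is at most `z`, so every form is at most `z * x` in
    -- absolute value on `[1, x]`.
    fun k hk a b hab _ => ⟨2 + ∑ i, ((|a i| + |b i| : ℤ) : ℝ), ?_, ?_⟩⟩
  · have : 0 ≤ ∑ i, ((|a i| + |b i| : ℤ) : ℝ) := sum_nonneg fun i _ => by
      push_cast; positivity
    linarith
  intro S _ hS2k hSa hSdet x z hx hz hzx
  have hnn : ∀ i, 0 ≤ ((|a i| + |b i| : ℤ) : ℝ) := fun i => by push_cast; positivity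
  have hle : ∀ i, ((|a i| + |b i| : ℤ) : ℝ) ≤ ∑ i, ((|a i| + |b i| : ℤ) : ℝ) := fun i =>
    single_le_sum (f := fun i => ((|a i| + |b i| : ℤ) : ℝ)) (fun i _ => hnn i) (mem_univ i)
  have hsum : 0 ≤ ∑ i, ((|a i| + |b i| : ℤ) : ℝ) := sum_nonneg fun i _ => hnn i
  refine he3 k _ hk S rfl a b ⟨fun p hp hpS => ?_, fun p hp hpS i h => hpS (hSa i p hp h),
    fun p hp hpS i j hij h => hpS (hSdet i j hij p hp h)⟩ (fun i => (hab i).1) x z hx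
    (by linarith) (fun i => by linarith [hle i]) hzx
  by_contra h
  exact hpS (hS2k p hp (not_lt.1 h))
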